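/- Let \(X=\{X_t;\,t\in[0,1]\}\) be a centered real Gaussian process with covariance function \(R\), and let \(V_n(X)=\sum_{k=1}^{n-1}\big(X_{(k+1)/n}+X_{(k-1)/n}-2X_{k/n}\big)^2\). For \(h>0\) put \(\delta_1^hR(s,t)=R(s+h,t)+R(s-h,t)-2R(s,t)\) and \(\delta_2^hR(s,t)=R(s,t+h)+R(s,t-h)-2R(s,t)\). Assume: 1. \(R\) is continuous on \([0,1]^2\). 2. The derivative \(\frac{\partial^4R}{\partial s^2\partial t^2}\) exists on \(]0,1]^2\setminus\{s=t\}\) (one-sided at the end point \(1\)), and there are a continuous function \(C:\{0\le t\le s\le1\}\to\mathbb R\), a real \(\gamma\in]0,2[\) and a positive Borel function \(L\) on \(]0,1]\), bounded on \([\delta,1]\) for every \(\delta\in]0,1[\) and slowly varying at \(0\) (that is, \(\lim_{x\to0^+}L(\lambda x)/L(x)=1\) for all \(\lambda>0\)), such that \[\frac{(s-t)^{2+\gamma}}{L(s-t)}\,\frac{\partial^4R}{\partial s^2\partial t^2}(s,t)=C(s,t)\qquad(0<t<s<1).\] 3. There are \(q\in\mathbb N=\{0,1,2,\dots\}\), functions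 \(g_0,\dots,g_q:]0,1[\to\mathbb R\), reals \(0<\nu_1<\dots<\nu_q\) and a function \(\phi:]0,1[\to]0,+\infty[\), with \(\lim_{h\to0^+}\phi(h)=0\) if \(q\ne0\), such that (a) \(g_i\) is Lipschitz on \(]0,1[\) for \(0\le i\le q-1\); (b) \(g_q\) is \((1/2+\alpha_q)\)-Hölder on \(]0,1[\) for some \(0<\alpha_q\le1/2\); (c) \(g_0(t)\ne0\) for some \(t\in]0,1[\); (d) \(\displaystyle\lim_{h\to0^+}\frac1{\sqrt h}\sup_{h\le t\le1-h}\Big|\frac{(\delta_1^h\circ\delta_2^hR)(t,t)}{h^{2-\gamma}L(h)}-g_0(t)-\sum_{i=1}^qg_i(t)\phi(h)^{\nu_i}\Big|=0\); (e) there is a bounded function \(\tilde g:]0,1[\to\mathbb R\) with \(\displaystyle\lim_{h\to0^+}\sup_{h\le t\le1-2h}\Big|\frac{(\delta_1^h\circ\delta_2^hR)(t+h,t)}{h^{2-\gamma}L(h)}-\tilde g(t)\Big|=0\). Then, as \(n\to+\infty\), \[\sqrt n\Big(\frac{n^{1-\gamma}}{L(1/n)}V_n(X)-\int_0^1g_0(x)\,dx-\sum_{i=1}^q\int_0^1g_i(x)\,dx\;\phi(1/n)^{\nu_i}\Big)\longrightarrow\mathcal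 N(0,\sigma^2)\quad\text{in law},\] where, with \[\rho_\gamma(l)=\int_l^{l+1}du\int_{u-1}^{u}dv\int_0^1dx\int_{x-1}^x\frac{dy}{(v-y)^{2+\gamma}},\qquad \|\rho_\gamma\|^2=\sum_{l=2}^{+\infty}\rho_\gamma(l)^2,\] \[\sigma^2=2\int_0^1g_0(x)^2dx+4\int_0^1\tilde g(x)^2dx+4\|\rho_\gamma\|^2\int_0^1C(x,x)^2dx,\] all these integrals and the series being convergent. -/

import Mathlib

open MeasureTheory ProbabilityTheory Filter Set Topology
open scoped ENNReal NNReal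

namespace QuadVar

noncomputable section

/-- The covariance function `R(s, t)` of the process `X`. -/
def covFun {Ω : Type*} [MeasurableSpace Ω] (P : Measure Ω) (X : ℝ → Ω → ℝ) (s t : ℝ) : ℝ :=
  cov[X s, X t; P]

/-- Second-order increment in the first variable. -/
def delta1 (h : ℝ) (R : ℝ → ℝ → ℝ) (s t : ℝ) : ℝ :=
  R (s + h) t + R (s - h) t - 2 * R s t

/-- Second-order increment in the second variable. -/
def delta2 (h : ℝ) (R : ℝ → ℝ → ℝ) (s t : ℝ) : ℝ :=
  R s (t + h) + R s (t - h) - 2 * R s t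

/-- Second-order quadratic variation
`V_n(X) = ∑_{k=1}^{n-1} (X_{(k+1)/n} + X_{(k-1)/n} - 2 X_{k/n})²`. -/
def V {Ω : Type*} (X : ℝ → Ω → ℝ) (n : ℕ) (ω : Ω) : ℝ :=
  ∑ k ∈ Finset.Ico 1 n,
    (X (((k : ℝ) + 1) / n) ω + X (((k : ℝ) - 1) / n) ω - 2 * X ((k : ℝ) / n) ω) ^ 2

/-- A positive Borel function on `]0, 1]`, slowly varying at `0`. -/
structure IsSlowlyVarying (L : ℝ → ℝ) : Prop where
  measurable : Measurable fun x : Ioc (0 : ℝ) 1 => L x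
  pos : ∀ x ∈ Ioc (0 : ℝ) 1, 0 < L x
  tendsto : ∀ c : ℝ, 0 < c → Tendsto (fun x => L (c * x) / L x) (𝓝[>] 0) (𝓝 1)

/-- On `]0, 1]² ∖ {s = t}` the derivative `∂⁴R/∂s²∂t² = ∂²/∂s² (∂²R/∂t²)` exists and equals `D`.
Here `A`, `B`, `E` are `∂R/∂t`, `∂²R/∂t²`, `∂³R/∂s∂t²`. Derivatives are taken within `]0, 1]`,
hence are one-sided at the end point `1`. -/
def HasMixedDeriv (R D : ℝ → ℝ → ℝ) : Prop :=
  ∃ A B E : ℝ → ℝ → ℝ, ∀ s ∈ Ioc (0 : ℝ) 1, ∀ t ∈ Ioc (0 : ℝ) 1, s ≠ t →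
    HasDerivWithinAt (fun u => R s u) (A s t) (Ioc 0 1) t ∧
    HasDerivWithinAt (fun u => A s u) (B s t) (Ioc 0 1) t ∧
    HasDerivWithinAt (fun u => B u t) (E s t) (Ioc 0 1) s ∧
    HasDerivWithinAt (fun u => E u t) (D s t) (Ioc 0 1) s

/-- `sup_{t ∈ S} |F t|`, as an extended nonnegative number. -/
def supAbs (S : Set ℝ) (F : ℝ → ℝ) : ℝ≥0∞ :=
  ⨆ t ∈ S, ENNReal.ofReal |F t|

/-- `∫_j^{j+1} du ∫_{u-1}^u dv ∫_k^{k+1} dx ∫_{x-1}^x (v - y)^{-(2+γ)} dy`. -/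
def rho₂ (γ j k : ℝ) : ℝ :=
  ∫ u in j..(j + 1), ∫ v in (u - 1)..u, ∫ x in k..(k + 1), ∫ y in (x - 1)..x,
    1 / (v - y) ^ (2 + γ)

/-- `ρ_γ(l)`: the integral above depends only on `l = j - k`. -/
def rho (γ : ℝ) (l : ℕ) : ℝ := rho₂ γ l 0

/-- `‖ρ_γ‖² = ∑_{l ≥ 2} ρ_γ(l)²`. -/
def rhoNormSq (γ : ℝ) : ℝ := ∑' l : ℕ, rho γ (l + 2) ^ 2

/-- The asymptotic variance. -/
def sigmaSq (γ : ℝ) (g₀ gt : ℝ → ℝ) (C : ℝ → ℝ → ℝ) : ℝ :=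
  2 * (∫ x in (0 : ℝ)..1, g₀ x ^ 2) + 4 * (∫ x in (0 : ℝ)..1, gt x ^ 2)
    + 4 * rhoNormSq γ * ∫ x in (0 : ℝ)..1, C x x ^ 2

end

end QuadVar

/-! The variable V_n is the squared norm of the Gaussian vector of second increments on the grid. In
an orthonormal eigenbasis of its covariance matrix the coordinates are independent, so V_n - E V_n
has the law of ∑ w_i (ξ_i² - 1), with ξ_i independent standard normal variables and w_i the
eigenvalues. After scaling, such a sum is asymptotically normal once twice the sum of the squared
weights converges and the largest weight tends to 0. The eigenvalues themselves are never needed: ∑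
w_i² is the sum of all squared covariances, and by Gershgorin's theorem max |w_i| is at most the
largest absolute row sum. This is `tendstoInDistribution_sum_sq`.

With h = 1/n, the scaled covariances are n^{-1/2} times the mixed second differences of R divided by
h^{2-γ} L(h). At lags 0 and 1 these tend to g_0 and to `gt` by hypothesis. At a lag l ≥ 2 the mixed
difference is h⁴ times the average, over a four-dimensional unit cube, of the fourth derivative
L(s-t) C(s,t) (s-t)^{-(2+γ)} (`mixed_second_difference`). The diagonal is met only for l = 2, at one
vertex of the cube, and 2+γ < 4 makes the singularity integrable. A Potter bound on L gives a bound
summable in l and uniform in h (`normDelta_eq_integral`), and the limit is ρ_γ(l) C(t,t), uniformly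
in t (`normDelta_tendsto_uniformly`). Dominated convergence over the diagonals of the matrix
(`tendsto_double_sum_of_diagonals`) produces σ², while the row sums are O(n^{-1/2}).

The mean of V_n is a sum of diagonal terms. Their expansion has error o(n^{-1/2}), and the Riemann
sums of the g_i, which are Hölder of exponent above 1/2, converge faster than n^{-1/2}. So the
centering in the statement differs from the true mean by a negligible bias (`tendsto_bias`). -/

namespace QuadVar

/-! ### Slowly varying functions and the Potter bound. -/

/-- If `f (x + u) - f x → 0` at infinity for every `u` and `f` is measurable, the increments over
steps of length at most one are eventually bounded. -/
lemma exists_bound_increment {f : ℝ → ℝ} (hf : Measurable f)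
    (hlim : ∀ u : ℝ, Tendsto (fun x => f (x + u) - f x) atTop (𝓝 0)) :
    ∃ a : ℝ, ∀ x ≥ a, ∀ u ∈ Icc (0 : ℝ) 1, |f (x + u) - f x| ≤ 2 := by
  by_contra! hcon
  choose x hx u hu hxu using fun n : ℕ => hcon n
  have hxt : Tendsto x atTop atTop := tendsto_atTop_mono hx tendsto_natCast_atTop_atTop
  -- The sets of good shifts `v` increase to the whole of [0, 2], which has measure 2, so they
  -- eventually have measure above 3/2.
  have key : ∀ y : ℕ → ℝ, Tendsto y atTop atTop →
      ∀ᶠ n in atTop, ENNReal.ofReal (3 / 2) <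
        volume {v ∈ Icc (0 : ℝ) 2 | ∀ m ≥ n, |f (y m + v) - f (y m)| ≤ 1} := by
    intro y hy
    set A : ℕ → Set ℝ := fun n => {v ∈ Icc (0 : ℝ) 2 | ∀ m ≥ n, |f (y m + v) - f (y m)| ≤ 1}
    have hmono : Monotone A := fun n n' hn v hv => ⟨hv.1, fun m hm => hv.2 m (hn.trans hm)⟩
    have hU : (⋃ n, A n) = Icc (0 : ℝ) 2 := by
      ext v
      simp only [mem_iUnion]
      refine ⟨fun ⟨n, hn⟩ => hn.1, fun hv => ?_⟩
      have h1 := ((hlim v).comp hy).eventually (Metric.ball_mem_nhds (0 : ℝ) one_pos)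
      obtain ⟨n, hn⟩ := eventually_atTop.1 h1
      refine ⟨n, hv, fun m hm => ?_⟩
      have := hn m hm
      rw [dist_zero_right, Real.norm_eq_abs] at this
      exact this.le
    have ht := tendsto_measure_iUnion_atTop (μ := volume) hmono
    rw [hU, Real.volume_Icc] at ht
    refine ht.eventually (lt_mem_nhds ?_)
    rw [ENNReal.ofReal_lt_ofReal_iff] <;> norm_num
  have hyu : Tendsto (fun n => x n + u n) atTop atTop :=
    tendsto_atTop_mono (fun n => by linarith [(hu n).1]) hxt
  obtain ⟨n, hV, hW⟩ := ((key x hxt).and (key _ hyu)).exists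
  set V := {v ∈ Icc (0 : ℝ) 2 | ∀ m ≥ n, |f (x m + v) - f (x m)| ≤ 1} with hVdef
  set W := {v ∈ Icc (0 : ℝ) 2 | ∀ m ≥ n, |f (x m + u m + v) - f (x m + u m)| ≤ 1} with hWdef
  have hWm : MeasurableSet W := by
    have : W = Icc (0 : ℝ) 2 ∩ ⋂ m, ⋂ (_ : m ≥ n),
        {v | |f (x m + u m + v) - f (x m + u m)| ≤ 1} := by
      ext v; simp [hWdef]
    rw [this]
    refine measurableSet_Icc.inter (MeasurableSet.iInter fun m => MeasurableSet.iInter fun _ => ?_)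
    exact measurableSet_le (by fun_prop) measurable_const
  -- `W'` is `W` translated by `u n`. Both `V` and `W'` lie in [0, 3] and have measure above 3/2, so
  -- they meet. A common point `v` makes `x n + v` a relay between `x n` and `x n + u n`, at cost 1
  -- on each side.
  set W' := (fun v => -u n + v) ⁻¹' W with hW'def
  have hW'm : MeasurableSet W' := hWm.preimage (by fun_prop)
  have hW'vol : volume W' = volume W := measure_preimage_add _ _ _
  have hsub : V ∪ W' ⊆ Icc 0 3 := by
    rintro v (hv | hv)
    · exact ⟨hv.1.1, hv.1.2.trans (by norm_num)⟩
    · have h1 := hv.1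
      have h2 := hu n
      exact ⟨by linarith [h1.1, h2.1], by linarith [h1.2, h2.2]⟩
  have hne : (V ∩ W').Nonempty := by
    rw [nonempty_iff_ne_empty]
    intro he
    have hd : Disjoint V W' := disjoint_iff_inter_eq_empty.2 he
    have h1 := measure_mono (μ := volume) hsub
    rw [measure_union hd hW'm, hW'vol, Real.volume_Icc] at h1
    have h2 := ENNReal.add_lt_add hV hW
    rw [← ENNReal.ofReal_add (by norm_num) (by norm_num)] at h2
    have h3 := h2.trans_le h1
    norm_num at h3
  obtain ⟨v, hv, hv'⟩ := hne
  have h1 := hv.2 n le_rfl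
  have h2 := hv'.2 n le_rfl
  have h3 := hxu n
  rw [show x n + u n + (-u n + v) = x n + v by ring] at h2
  have : |f (x n + u n) - f (x n)| ≤ 1 + 1 := by
    calc |f (x n + u n) - f (x n)|
        = |(f (x n + v) - f (x n)) - (f (x n + v) - f (x n + u n))| := by congr 1; ring
      _ ≤ _ := abs_sub _ _
      _ ≤ 1 + 1 := add_le_add h1 h2
  linarith

/-- Far out, each unit step costs at most `ε`, and the remaining fraction of a step costs at most 2
by `exists_bound_increment`. -/
lemma exists_linear_bound_increment {f : ℝ → ℝ} (hf : Measurable f)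
    (hlim : ∀ u : ℝ, Tendsto (fun x => f (x + u) - f x) atTop (𝓝 0)) {ε : ℝ} (hε : 0 < ε) :
    ∃ a : ℝ, ∀ x ≥ a, ∀ y ≥ a, |f y - f x| ≤ ε * |y - x| + 2 := by
  obtain ⟨a, ha⟩ := exists_bound_increment hf hlim
  obtain ⟨b, hb⟩ := eventually_atTop.1 ((hlim 1).eventually (Metric.ball_mem_nhds (0 : ℝ) hε))
  have hstep : ∀ n : ℕ, ∀ x ≥ b, |f (x + n) - f x| ≤ ε * n := by
    intro n
    induction n with
    | zero => intro x _; simp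
    | succ n ih =>
      intro x hx
      have h1 := ih x hx
      have h2 := hb (x + n) (le_add_of_le_of_nonneg hx (Nat.cast_nonneg n))
      rw [dist_zero_right, Real.norm_eq_abs] at h2
      push_cast
      rw [← add_assoc]
      calc |f (x + n + 1) - f x| = |(f (x + n + 1) - f (x + n)) + (f (x + n) - f x)| := by ring_nf
        _ ≤ _ := abs_add_le _ _
        _ ≤ ε * (n + 1) := by linarith
  have key : ∀ x ≥ max a b, ∀ y ≥ x, |f y - f x| ≤ ε * |y - x| + 2 := by
    intro x hx y hxy
    have hxa : x ≥ a := le_trans (le_max_left _ _) hx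
    have hxb : x ≥ b := le_trans (le_max_right _ _) hx
    set n := ⌊y - x⌋₊
    have hn : (n : ℝ) ≤ y - x := Nat.floor_le (by linarith)
    have hn' : y - x < n + 1 := Nat.lt_floor_add_one _
    have h1 := hstep n x hxb
    have h2 := ha (x + n) (by linarith [Nat.cast_nonneg (α := ℝ) n]) (y - x - n)
      ⟨by linarith, by linarith⟩
    rw [show x + n + (y - x - n) = y by ring] at h2
    rw [abs_of_nonneg (sub_nonneg.2 hxy)]
    calc |f y - f x| = |(f (x + n) - f x) + (f y - f (x + n))| := by ring_nf
      _ ≤ _ := abs_add_le _ _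
      _ ≤ ε * (y - x) + 2 := by nlinarith
  refine ⟨max a b, fun x hx y hy => ?_⟩
  rcases le_total x y with h | h
  · exact key x hx y h
  · rw [abs_sub_comm (f y), abs_sub_comm y]; exact key y hy x h

lemma exp_mul_abs_log_le {r ε : ℝ} (hr : 0 < r) :
    Real.exp (ε * |Real.log r|) ≤ r ^ ε + r⁻¹ ^ ε := by
  have h1 : 0 ≤ r ^ ε := by positivity
  have h2 : 0 ≤ r⁻¹ ^ ε := by positivity
  rcases abs_cases (Real.log r) with ⟨h, -⟩ | ⟨h, -⟩
  · rw [h, mul_comm, ← Real.rpow_def_of_pos hr]; linarith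
  · rw [h, mul_comm, ← Real.log_inv, ← Real.rpow_def_of_pos (by positivity)]; linarith

lemma IsSlowlyVarying.measurable_indicator {L : ℝ → ℝ} (hL : IsSlowlyVarying L) :
    Measurable ((Ioc (0 : ℝ) 1).indicator L) := by
  refine measurable_of_restrict_of_restrict_compl (s := Ioc (0 : ℝ) 1) measurableSet_Ioc ?_ ?_
  · convert! hL.measurable using 2 with x
    exact indicator_of_mem x.2 L
  · convert! (measurable_const : Measurable fun _ : ↥(Ioc (0 : ℝ) 1)ᶜ => (0 : ℝ)) using 2 with x
    exact indicator_of_notMem x.2 L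

/-- A Potter bound for a slowly varying function. -/
lemma IsSlowlyVarying.potter {L : ℝ → ℝ} (hL : IsSlowlyVarying L)
    (hbdd : ∀ δ : ℝ, 0 < δ → BddAbove (L '' Icc δ 1)) {ε : ℝ} (hε : 0 < ε) :
    ∃ A > 0, ∃ h₀ > 0, h₀ ≤ 1 ∧ ∀ h ∈ Ioc 0 h₀, ∀ x ∈ Ioc (0 : ℝ) 1,
      L x / L h ≤ A * ((x / h) ^ ε + (x / h)⁻¹ ^ ε) := by
  -- In the variable x = -log(argument), slow variation says that the increments of log L tend to 0.
  -- A linear bound with slope `ε` on them then exponentiates to a power bound with exponent `ε`.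
  set f : ℝ → ℝ := fun x => Real.log ((Ioc (0 : ℝ) 1).indicator L (Real.exp (-x))) with hfdef
  have hfm : Measurable f :=
    Real.measurable_log.comp (hL.measurable_indicator.comp (by fun_prop))
  have hfe : ∀ x, 0 ≤ x → f x = Real.log (L (Real.exp (-x))) := by
    intro x hx
    have : Real.exp (-x) ∈ Ioc (0 : ℝ) 1 := ⟨Real.exp_pos _, Real.exp_le_one_iff.2 (by linarith)⟩
    simp only [hfdef]
    rw [indicator_of_mem this]
  have hlim : ∀ u : ℝ, Tendsto (fun x => f (x + u) - f x) atTop (𝓝 0) := by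
    intro u
    have h1 := hL.tendsto (Real.exp (-u)) (Real.exp_pos _)
    have h2 : Tendsto (fun x : ℝ => Real.exp (-x)) atTop (𝓝[>] 0) :=
      tendsto_nhdsWithin_iff.2 ⟨Real.tendsto_exp_neg_atTop_nhds_zero,
        Eventually.of_forall fun x => Real.exp_pos _⟩
    have h3 := (Real.continuousAt_log one_ne_zero).tendsto.comp (h1.comp h2)
    rw [Real.log_one] at h3
    refine h3.congr' ?_
    filter_upwards [eventually_ge_atTop (max 0 (-u))] with x hx
    have hx0 : 0 ≤ x := le_trans (le_max_left _ _) hx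
    have hxu : 0 ≤ x + u := by linarith [le_max_right 0 (-u)]
    have m1 : Real.exp (-x) ∈ Ioc (0 : ℝ) 1 := ⟨Real.exp_pos _, Real.exp_le_one_iff.2 (by linarith)⟩
    have m2 : Real.exp (-(x + u)) ∈ Ioc (0 : ℝ) 1 :=
      ⟨Real.exp_pos _, Real.exp_le_one_iff.2 (by linarith)⟩
    rw [hfe _ hx0, hfe _ hxu]
    simp only [Function.comp_apply]
    rw [← Real.exp_add, show -u + -x = -(x + u) by ring,
      Real.log_div (hL.pos _ m2).ne' (hL.pos _ m1).ne']
  obtain ⟨a, ha⟩ := exists_linear_bound_increment hfm hlim hε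
  set b := max a 0
  set h₀ := Real.exp (-b) with hh₀
  have h₀pos : 0 < h₀ := Real.exp_pos _
  have h₀le : h₀ ≤ 1 := Real.exp_le_one_iff.2 (by linarith [le_max_right a 0])
  have near : ∀ h ∈ Ioc 0 h₀, ∀ x ∈ Ioc 0 h₀,
      L x / L h ≤ Real.exp 2 * ((x / h) ^ ε + (x / h)⁻¹ ^ ε) := by
    intro h hh x hx
    have e : ∀ y ∈ Ioc 0 h₀, b ≤ -Real.log y := by
      intro y hy
      have := Real.log_le_log hy.1 hy.2
      rw [hh₀, Real.log_exp] at this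
      linarith
    have e' : ∀ y ∈ Ioc 0 h₀, f (-Real.log y) = Real.log (L y) := by
      intro y hy
      rw [hfe _ ((le_max_right a 0).trans (e y hy)), neg_neg, Real.exp_log hy.1]
    have hLx := hL.pos x ⟨hx.1, hx.2.trans h₀le⟩
    have hLh := hL.pos h ⟨hh.1, hh.2.trans h₀le⟩
    have h1 := ha _ ((le_max_left a 0).trans (e h hh)) _ ((le_max_left a 0).trans (e x hx))
    rw [e' x hx, e' h hh, ← Real.log_div hLx.ne' hLh.ne'] at h1
    have h2 : |-Real.log x - -Real.log h| = |Real.log (x / h)| := by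
      rw [Real.log_div hx.1.ne' hh.1.ne', ← abs_neg]; congr 1; ring
    rw [h2] at h1
    calc L x / L h = Real.exp (Real.log (L x / L h)) := (Real.exp_log (by positivity)).symm
      _ ≤ Real.exp (2 + ε * |Real.log (x / h)|) :=
        Real.exp_le_exp.2 ((le_abs_self _).trans (by linarith))
      _ = Real.exp 2 * Real.exp (ε * |Real.log (x / h)|) := Real.exp_add _ _
      _ ≤ _ := by gcongr; exact exp_mul_abs_log_le (div_pos hx.1 hh.1)
  obtain ⟨M, hM⟩ := hbdd h₀ h₀pos
  have hLh₀ := hL.pos h₀ ⟨h₀pos, h₀le⟩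
  have hM0 : L h₀ ≤ M := hM ⟨h₀, ⟨le_rfl, h₀le⟩, rfl⟩
  have hMdiv : 1 ≤ M / L h₀ := (one_le_div hLh₀).2 hM0
  refine ⟨M / L h₀ * (2 * Real.exp 2), by positivity, h₀, h₀pos, h₀le, fun h hh x hx => ?_⟩
  have hr : 0 < x / h := div_pos hx.1 hh.1
  have hLh := hL.pos h ⟨hh.1, hh.2.trans h₀le⟩
  rcases le_or_gt x h₀ with hxh | hxh
  · refine (near h hh x ⟨hx.1, hxh⟩).trans ?_
    gcongr
    nlinarith [Real.exp_pos 2]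
  -- For `x` above `h₀` the comparison passes through `L h₀`. The bound `M` on [h₀, 1] gives the
  -- factor `M / L h₀`, and the factor 2 absorbs the negative power, which is at most the positive
  -- one because `h ≤ h₀`.
  · have h1 := near h hh h₀ ⟨h₀pos, le_rfl⟩
    have h2 : 1 ≤ h₀ / h := (one_le_div hh.1).2 hh.2
    have h3 : (h₀ / h)⁻¹ ^ ε ≤ (h₀ / h) ^ ε := by
      gcongr
      exact (inv_le_one_of_one_le₀ h2).trans h2
    have h4 : (h₀ / h) ^ ε ≤ (x / h) ^ ε := by
      have := hh.1
      gcongr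
    have h5 : L x ≤ M := hM ⟨x, ⟨hxh.le, hx.2⟩, rfl⟩
    have h6 : 0 ≤ (x / h)⁻¹ ^ ε := by positivity
    calc L x / L h = (L x / L h₀) * (L h₀ / L h) := by field_simp
      _ ≤ (M / L h₀) * (Real.exp 2 * ((h₀ / h) ^ ε + (h₀ / h)⁻¹ ^ ε)) := by gcongr
      _ ≤ (M / L h₀) * (Real.exp 2 * ((x / h) ^ ε + (x / h) ^ ε)) := by
          have := h3.trans h4
          gcongr ?_ * (?_ * (?_ + ?_))
      _ = M / L h₀ * (2 * Real.exp 2) * (x / h) ^ ε := by ring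
      _ ≤ _ := by gcongr; linarith

/-! ### The centered chi-square characteristic function and products of it. -/

noncomputable section

/-- The characteristic function of `ξ² - 1` where `ξ` is a standard normal variable. -/
def centeredChiSqCharFun (u : ℝ) : ℂ :=
  charFun ((gaussianReal 0 1).map (fun x => x ^ 2 - 1)) u

instance isProbabilityMeasure_map_sq_sub_one :
    IsProbabilityMeasure ((gaussianReal 0 1).map (fun x : ℝ => x ^ 2 - 1)) :=
  Measure.isProbabilityMeasure_map (by fun_prop)

lemma norm_centeredChiSqCharFun_le_one (u : ℝ) : ‖centeredChiSqCharFun u‖ ≤ 1 :=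
  norm_charFun_le_one u

/-- The moment is the fourth derivative at 0 of the moment generating function exp(t²/2). It is
needed for the variance of ξ² - 1. -/
lemma integral_pow_four_gaussianReal : ∫ x, x ^ 4 ∂(gaussianReal 0 1) = 3 := by
  have h := iteratedDeriv_mgf_zero (X := id) (μ := gaussianReal 0 1)
    (by rw [integrableExpSet_id_gaussianReal]; simp) 4
  have hm : mgf id (gaussianReal 0 1) = fun t => Real.exp (t ^ 2 / 2) := by
    rw [mgf_id_gaussianReal]; simp
  rw [hm] at h
  have hb : ∀ t : ℝ, HasDerivAt (fun t => Real.exp (t ^ 2 / 2)) (t * Real.exp (t ^ 2 / 2)) t := by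
    intro t
    convert! ((hasDerivAt_pow 2 t).div_const 2).exp using 1
    push_cast; ring
  have d1 : deriv (fun t : ℝ => Real.exp (t ^ 2 / 2)) = fun t => t * Real.exp (t ^ 2 / 2) :=
    funext fun t => (hb t).deriv
  have d2 : deriv (fun t : ℝ => t * Real.exp (t ^ 2 / 2)) =
      fun t => (1 + t ^ 2) * Real.exp (t ^ 2 / 2) := funext fun t => by
    refine HasDerivAt.deriv ?_
    convert! (hasDerivAt_id t).mul (hb t) using 1
    simp only [id]; ring
  have d3 : deriv (fun t : ℝ => (1 + t ^ 2) * Real.exp (t ^ 2 / 2)) =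
      fun t => (3 * t + t ^ 3) * Real.exp (t ^ 2 / 2) := funext fun t => by
    refine HasDerivAt.deriv ?_
    convert! ((hasDerivAt_pow 2 t).const_add 1).mul (hb t) using 1
    push_cast; ring
  have d4 : deriv (fun t : ℝ => (3 * t + t ^ 3) * Real.exp (t ^ 2 / 2)) =
      fun t => (3 + 6 * t ^ 2 + t ^ 4) * Real.exp (t ^ 2 / 2) := funext fun t => by
    refine HasDerivAt.deriv ?_
    convert! (((hasDerivAt_id t).const_mul 3).add (hasDerivAt_pow 3 t)).mul (hb t) using 1
    simp only [id, Pi.add_apply]; push_cast; ring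
  rw [iteratedDeriv_succ', iteratedDeriv_succ', iteratedDeriv_succ', iteratedDeriv_succ',
    iteratedDeriv_zero, d1, d2, d3, d4] at h
  simpa using h.symm

lemma integrable_pow_gaussianReal (k : ℕ) : Integrable (fun x => x ^ k) (gaussianReal 0 1) := by
  have := (memLp_id_gaussianReal (μ := 0) (v := 1) k).integrable_norm_pow'
  refine (integrable_norm_iff (by fun_prop)).1 ?_
  simpa using this

lemma integral_sq_gaussianReal : ∫ x, x ^ 2 ∂(gaussianReal 0 1) = 1 := by
  have h := variance_fun_id_gaussianReal (μ := 0) (v := 1)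
  rw [variance_eq_integral (by fun_prop)] at h
  simpa [integral_id_gaussianReal] using h

/-- The variable ξ² - 1 has mean 0 and variance 3 - 1 = 2, so both functions are 1 - u² + o(u²). The
factor 1/√2 in `X` normalises the variance to 1, as the second-order Taylor expansion of a
characteristic function requires. -/
lemma centeredChiSqCharFun_isLittleO :
    (fun u => centeredChiSqCharFun u - Complex.exp (-(u : ℂ) ^ 2)) =o[𝓝 0] fun u => u ^ 2 := by
  set X : ℝ → ℝ := fun x => (√2)⁻¹ * (x ^ 2 - 1) with hX
  have i2 := integrable_pow_gaussianReal 2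
  have i4 := integrable_pow_gaussianReal 4
  have h0 : (gaussianReal 0 1)[X] = 0 := by
    simp only [hX]
    rw [integral_const_mul, integral_sub i2 (integrable_const _), integral_sq_gaussianReal]
    simp
  have h1 : (gaussianReal 0 1)[X ^ 2] = 1 := by
    have : X ^ 2 = fun x => 2⁻¹ * (x ^ 4 - 2 * x ^ 2 + 1) := by
      ext x
      simp only [hX, Pi.pow_apply, mul_pow, inv_pow]
      rw [Real.sq_sqrt (by norm_num)]
      ring
    rw [this, integral_const_mul, integral_add (f := fun x => x ^ 4 - 2 * x ^ 2) (i4.sub (i2.const_mul 2))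
        (integrable_const _),
      integral_sub i4 (i2.const_mul 2), integral_const_mul, integral_sq_gaussianReal,
      integral_pow_four_gaussianReal]
    simp; norm_num
  have ht := taylor_charFun_two (X := X) (P := gaussianReal 0 1) (by fun_prop) h0 h1
  have hlim : Tendsto (fun u : ℝ => √2 * u) (𝓝 0) (𝓝 0) := by
    have : Continuous fun u : ℝ => √2 * u := by fun_prop
    simpa using this.tendsto 0
  have ht2 := ht.comp_tendsto hlim
  have e1 : (fun u => centeredChiSqCharFun u - (1 - (u : ℂ) ^ 2)) =o[𝓝 0] fun u => u ^ 2 := by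
    have : (fun u : ℝ => (√2 * u) ^ 2) = fun u => 2 * u ^ 2 := by
      ext u; rw [mul_pow, Real.sq_sqrt (by norm_num)]
    have h3 : ((fun t => t ^ 2) ∘ fun u : ℝ => √2 * u) = fun u => 2 * u ^ 2 := this
    rw [h3] at ht2
    refine (ht2.trans_isBigO (Asymptotics.isBigO_const_mul_self 2 _ _)).congr_left fun u => ?_
    simp only [Function.comp_apply]
    have e2 : charFun ((gaussianReal 0 1).map X) (√2 * u) = centeredChiSqCharFun u := by
      rw [hX, charFun_map_mul_comp (by fun_prop), centeredChiSqCharFun, ← mul_assoc,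
        inv_mul_cancel₀ (by positivity), one_mul]
    rw [e2]
    congr 2
    have : ((√2 : ℝ) : ℂ) ^ 2 = 2 := by
      rw [← Complex.ofReal_pow, Real.sq_sqrt (by norm_num)]; simp
    push_cast
    rw [mul_pow, this]; ring
  have e3 : (fun u : ℝ => Complex.exp (-(u : ℂ) ^ 2) - (1 - (u : ℂ) ^ 2)) =o[𝓝 0]
      fun u => u ^ 2 := by
    have hd : HasDerivAt Complex.exp 1 0 := by simpa using Complex.hasDerivAt_exp 0
    have h4 := hasDerivAt_iff_isLittleO.1 hd
    have hl : Tendsto (fun u : ℝ => -(u : ℂ) ^ 2) (𝓝 0) (𝓝 0) := by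
      have : Continuous fun u : ℝ => -(u : ℂ) ^ 2 := by fun_prop
      simpa using this.tendsto 0
    have h5 := h4.comp_tendsto hl
    refine (h5.congr_left (f₂ := fun u : ℝ => Complex.exp (-(u : ℂ) ^ 2) - (1 - (u : ℂ) ^ 2))
      fun u => ?_).trans_isBigO ?_
    · simp; ring
    · refine Asymptotics.IsBigO.of_bound 1 (Eventually.of_forall fun u => ?_)
      simp
  exact (e1.sub e3).congr_left fun u => by ring

lemma norm_prod_sub_prod_le {ι : Type*} (s : Finset ι) (z w : ι → ℂ)
    (hz : ∀ i ∈ s, ‖z i‖ ≤ 1) (hw : ∀ i ∈ s, ‖w i‖ ≤ 1) :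
    ‖∏ i ∈ s, z i - ∏ i ∈ s, w i‖ ≤ ∑ i ∈ s, ‖z i - w i‖ := by
  classical
  induction s using Finset.induction_on with
  | empty => simp
  | insert a s ha ih =>
    rw [Finset.prod_insert ha, Finset.prod_insert ha, Finset.sum_insert ha]
    have ih' := ih (fun i hi => hz i (Finset.mem_insert_of_mem hi))
      (fun i hi => hw i (Finset.mem_insert_of_mem hi))
    have hzs : ‖∏ i ∈ s, z i‖ ≤ 1 := by
      rw [norm_prod]
      exact Finset.prod_le_one (fun _ _ => norm_nonneg _)
        fun i hi => hz i (Finset.mem_insert_of_mem hi)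
    calc ‖z a * ∏ i ∈ s, z i - w a * ∏ i ∈ s, w i‖
        = ‖(z a - w a) * ∏ i ∈ s, z i + w a * (∏ i ∈ s, z i - ∏ i ∈ s, w i)‖ := by ring_nf
      _ ≤ ‖z a - w a‖ * ‖∏ i ∈ s, z i‖ + ‖w a‖ * ‖∏ i ∈ s, z i - ∏ i ∈ s, w i‖ := by
        refine (norm_add_le _ _).trans ?_
        rw [norm_mul, norm_mul]
      _ ≤ ‖z a - w a‖ * 1 + 1 * ∑ i ∈ s, ‖z i - w i‖ := by
        gcongr
        exact hw a (Finset.mem_insert_self _ _)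
      _ = _ := by ring

/-- Each factor is replaced by exp(-a²). Since the largest |a| tends to 0, the o(u²) estimate
applies to all factors at once, and the total error is a small multiple of ∑ a², which stays
bounded. -/
lemma tendsto_prod_centeredChiSqCharFun {ι : ℕ → Type} [∀ n, Fintype (ι n)]
    {a : (n : ℕ) → ι n → ℝ} {s : ℝ}
    (hsum : Tendsto (fun n => ∑ i, a n i ^ 2) atTop (𝓝 s))
    (hmax : ∀ δ > 0, ∀ᶠ n in atTop, ∀ i, |a n i| < δ) :
    Tendsto (fun n => ∏ i, centeredChiSqCharFun (a n i)) atTop (𝓝 (Complex.exp (-(s : ℂ)))) := by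
  have h1 : Tendsto (fun n => ∏ i, Complex.exp (-(a n i : ℂ) ^ 2)) atTop
      (𝓝 (Complex.exp (-(s : ℂ)))) := by
    have h2 : ∀ n, ∏ i, Complex.exp (-(a n i : ℂ) ^ 2) =
        Complex.exp (-((∑ i, a n i ^ 2 : ℝ) : ℂ)) := by
      intro n
      rw [← Complex.exp_sum]
      push_cast
      rw [Finset.sum_neg_distrib]
    simp_rw [h2]
    have : Continuous fun x : ℝ => Complex.exp (-(x : ℂ)) := by fun_prop
    exact (this.tendsto s).comp hsum
  have h3 : Tendsto (fun n => ∏ i, centeredChiSqCharFun (a n i) -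
      ∏ i, Complex.exp (-(a n i : ℂ) ^ 2)) atTop (𝓝 0) := by
    rw [Metric.tendsto_atTop']
    suffices h : ∀ ε > 0, ∀ᶠ n in atTop, ‖∏ i, centeredChiSqCharFun (a n i) -
        ∏ i, Complex.exp (-(a n i : ℂ) ^ 2)‖ < ε by
      intro ε hε
      obtain ⟨N, hN⟩ := eventually_atTop.1 (h ε hε)
      exact ⟨N, fun n hn => by simpa using hN n hn.le⟩
    intro ε hε
    have hs0 : 0 ≤ s := ge_of_tendsto' hsum fun n => Finset.sum_nonneg fun i _ => sq_nonneg _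
    -- The sum ∑ a² is eventually below s + 1, so a relative error of ε / (s + 1) adds up to less
    -- than `ε`.
    have hη : 0 < ε / (s + 1) := by positivity
    obtain ⟨δ, hδ, hδ'⟩ := Metric.eventually_nhds_iff.1
      (centeredChiSqCharFun_isLittleO.def hη)
    filter_upwards [hmax δ hδ, hsum.eventually (gt_mem_nhds (show s < s + 1 by linarith))]
      with n hn hn'
    calc _ ≤ ∑ i, ‖centeredChiSqCharFun (a n i) - Complex.exp (-(a n i : ℂ) ^ 2)‖ := by
          refine norm_prod_sub_prod_le _ _ _ (fun i _ => norm_centeredChiSqCharFun_le_one _)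
            fun i _ => ?_
          rw [Complex.norm_exp]
          have : (-(a n i : ℂ) ^ 2).re = -(a n i) ^ 2 := by
            rw [← Complex.ofReal_pow, ← Complex.ofReal_neg, Complex.ofReal_re]
          rw [this]
          exact Real.exp_le_one_iff.2 (by nlinarith [sq_nonneg (a n i)])
      _ ≤ ∑ i, ε / (s + 1) * a n i ^ 2 := by
          gcongr with i
          have := hδ' (y := a n i) (by simpa using hn i)
          simpa using this
      _ = ε / (s + 1) * ∑ i, a n i ^ 2 := by rw [Finset.mul_sum]
      _ < ε / (s + 1) * (s + 1) := by gcongr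
      _ = ε := by field_simp
  simpa using h3.add h1

end

/-! ### Sums of squares of Gaussian vectors. -/

section

variable {Ω : Type*} [MeasurableSpace Ω] {P : Measure Ω}

lemma charFun_map_sq_of_hasGaussianLaw {Y : Ω → ℝ} (hY : HasGaussianLaw Y P)
    (h0 : ∫ ω, Y ω ∂P = 0) (c t : ℝ) :
    charFun (P.map fun ω => c * (Y ω ^ 2 - Var[Y; P])) t =
      centeredChiSqCharFun (t * (c * Var[Y; P])) := by
  set v := Var[Y; P]
  have hv : 0 ≤ v := variance_nonneg _ _
  have h1 : P.map Y = (gaussianReal 0 1).map (fun x => √v * x) := by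
    rw [hY.map_eq_gaussianReal, h0, gaussianReal_map_const_mul]
    congr 1
    · simp
    · ext; simp [Real.sq_sqrt hv, v]
  have h2 : (P.map fun ω => c * (Y ω ^ 2 - v)) = (P.map Y).map fun x => c * (x ^ 2 - v) := by
    rw [AEMeasurable.map_map_of_aemeasurable (by fun_prop) hY.aemeasurable]
    rfl
  rw [h2, h1, Measure.map_map (by fun_prop) (by fun_prop)]
  have h3 : ((fun x => c * (x ^ 2 - v)) ∘ fun x => √v * x) = fun x => c * v * (x ^ 2 - 1) := by
    ext x
    simp only [Function.comp_apply, mul_pow, Real.sq_sqrt hv]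
    ring
  rw [h3, charFun_map_mul_comp (by fun_prop), centeredChiSqCharFun]
  ring_nf

lemma charFun_map_sum_sq {ι : Type*} [Fintype ι] {Y : ι → Ω → ℝ} [IsProbabilityMeasure P]
    (hY : HasGaussianLaw (fun ω i => Y i ω) P) (h0 : ∀ i, ∫ ω, Y i ω ∂P = 0)
    (hind : iIndepFun Y P) (c b t : ℝ) :
    charFun (P.map fun ω => c * (∑ i, Y i ω ^ 2 - ∑ i, Var[Y i; P]) + b) t =
      Complex.exp (t * b * Complex.I) * ∏ i, centeredChiSqCharFun (t * (c * Var[Y i; P])) := by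
  have hYm : ∀ i, AEMeasurable (Y i) P := fun i => (hY.eval i).aemeasurable
  have hm : AEMeasurable (fun ω => ∑ i, c * (Y i ω ^ 2 - Var[Y i; P])) P :=
    Finset.aemeasurable_fun_sum _ fun i _ => (((hYm i).pow_const 2).sub_const _).const_mul c
  have e1 : (fun ω => c * (∑ i, Y i ω ^ 2 - ∑ i, Var[Y i; P]) + b) =
      (fun x => x + b) ∘ fun ω => ∑ i, c * (Y i ω ^ 2 - Var[Y i; P]) := by
    ext ω
    simp only [Function.comp_apply]
    rw [← Finset.sum_sub_distrib, Finset.mul_sum]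
  rw [e1, ← AEMeasurable.map_map_of_aemeasurable (by fun_prop) hm, charFun_map_add_const]
  have hi : iIndepFun (fun i ω => c * (Y i ω ^ 2 - Var[Y i; P])) P :=
    hind.comp (fun i x => c * (x ^ 2 - Var[Y i; P])) fun i => by fun_prop
  rw [iIndepFun.charFun_map_fun_sum_eq_prod
    (fun i => (((hYm i).pow_const 2).sub_const _).const_mul c) hi, Finset.prod_apply, mul_comm]
  congr 1
  · simp [mul_comm]
  · exact Finset.prod_congr rfl fun i _ => charFun_map_sq_of_hasGaussianLaw (hY.eval i) (h0 i) c t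

open Matrix in
/-- The centered sum of squares of a Gaussian vector has the law of a weighted sum of independent
centered chi-square variables, the weights being the eigenvalues of the covariance matrix. -/
lemma exists_weights_charFun_sum_sq {ι : Type*} [Fintype ι] {Z : ι → Ω → ℝ}
    [IsProbabilityMeasure P]
    (hZ : HasGaussianLaw (fun ω i => Z i ω) P) (h0 : ∀ i, ∫ ω, Z i ω ∂P = 0) :
    ∃ w : ι → ℝ, (∑ i, w i ^ 2 = ∑ i, ∑ j, cov[Z i, Z j; P] ^ 2) ∧
      (∀ i, ∃ j, |w i| ≤ ∑ k, |cov[Z j, Z k; P]|) ∧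
      ∀ c b t : ℝ, charFun (P.map fun ω => c * (∑ i, Z i ω ^ 2 - ∑ i, cov[Z i, Z i; P]) + b) t =
        Complex.exp (t * b * Complex.I) * ∏ i, centeredChiSqCharFun (t * (c * w i)) := by
  classical
  set S : Matrix ι ι ℝ := Matrix.of fun i j => cov[Z i, Z j; P] with hS
  have hSh : S.IsHermitian := by
    ext i j
    simp [hS, covariance_comm]
  set B := hSh.eigenvectorBasis
  set w := hSh.eigenvalues
  have hZ2 : ∀ i, MemLp (Z i) 2 P := fun i => (hZ.eval i).memLp_two
  have heig : ∀ i j, ∑ k, S i k * B j k = w j * B j i := by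
    intro i j
    have := congrFun (hSh.mulVec_eigenvectorBasis j) i
    simpa [Matrix.mulVec, dotProduct] using this
  -- Parseval's identity in the eigenbasis. It is used both for the random vector, whose sum of
  -- squares is unchanged, and for the rows of the covariance matrix.
  have hnorm : ∀ x : ι → ℝ, ∑ j, (∑ i, B j i * x i) ^ 2 = ∑ i, x i ^ 2 := by
    intro x
    have := B.sum_sq_norm_inner_right (WithLp.toLp 2 x)
    rw [EuclideanSpace.norm_sq_eq] at this
    simpa [PiLp.inner_apply, mul_comm] using this
  have horth : ∀ j k, ∑ i, B j i * B k i = if j = k then 1 else 0 := by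
    intro j k
    have := orthonormal_iff_ite.1 B.orthonormal j k
    simpa [PiLp.inner_apply, mul_comm] using this
  set Y : ι → Ω → ℝ := fun j ω => ∑ i, B j i * Z i ω with hYdef
  have hcov : ∀ j k, cov[Y j, Y k; P] = if j = k then w k else 0 := by
    intro j k
    rw [hYdef]
    rw [covariance_fun_sum_fun_sum (fun i => (hZ2 i).const_mul _) (fun i => (hZ2 i).const_mul _)]
    have : ∀ i i', cov[fun ω => B j i * Z i ω, fun ω => B k i' * Z i' ω; P] =
        B j i * (S i i' * B k i') := by
      intro i i'
      rw [covariance_const_mul_left, covariance_const_mul_right]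
      simp only [hS, Matrix.of_apply]; ring
    simp_rw [this, ← Finset.mul_sum, heig]
    have h1 : ∀ i, B j i * (w k * B k i) = w k * (B j i * B k i) := fun i => by ring
    simp_rw [h1, ← Finset.mul_sum, horth]
    simp
  have hYg : HasGaussianLaw (fun ω j => Y j ω) P := by
    have := hZ.map_fun (ContinuousLinearMap.pi fun j =>
      ∑ i, B j i • (ContinuousLinearMap.proj i : (ι → ℝ) →L[ℝ] ℝ))
    convert! this using 3 with ω j
    simp [hYdef]
  have hYm : ∀ j, AEMeasurable (Y j) P := fun j => (hYg.eval j).aemeasurable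
  have hvar : ∀ j, Var[Y j; P] = w j := by
    intro j
    rw [← covariance_self (hYm j), hcov, if_pos rfl]
  have hY0 : ∀ j, ∫ ω, Y j ω ∂P = 0 := by
    intro j
    simp only [hYdef]
    rw [integral_finsetSum _ fun i _ => ((hZ2 i).integrable one_le_two).const_mul _]
    simp [integral_const_mul, h0]
  -- The coordinates are jointly Gaussian and uncorrelated, hence independent.
  have hind : iIndepFun Y P :=
    hYg.iIndepFun_of_covariance_eq_zero fun i j hij => by rw [hcov, if_neg hij]
  have htr : ∑ i, cov[Z i, Z i; P] = ∑ i, w i := by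
    have := hSh.trace_eq_sum_eigenvalues
    simpa [Matrix.trace, hS] using this
  refine ⟨w, ?_, ?_, ?_⟩
  · have h1 : ∀ i, ∑ j, cov[Z i, Z j; P] ^ 2 = ∑ j, w j ^ 2 * (B j i * B j i) := by
      intro i
      rw [← hnorm fun k => cov[Z i, Z k; P]]
      refine Finset.sum_congr rfl fun j _ => ?_
      have := heig i j
      simp only [hS, Matrix.of_apply] at this
      simp_rw [mul_comm (B j _)]
      rw [this]; ring
    simp_rw [h1]
    rw [Finset.sum_comm]
    simp_rw [← Finset.mul_sum, horth]
    simp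
  · intro i
    have hev : Module.End.HasEigenvalue (Matrix.toLin' S) (w i) := by
      refine Module.End.hasEigenvalue_of_hasEigenvector (x := (B i : ι → ℝ)) ⟨?_, ?_⟩
      · rw [Module.End.mem_eigenspace_iff, Matrix.toLin'_apply]
        exact hSh.mulVec_eigenvectorBasis i
      · intro h
        have := horth i i
        simp [h] at this
    -- Gershgorin's theorem: the eigenvalue lies within the off-diagonal absolute row sum of some
    -- diagonal entry.
    obtain ⟨k, hk⟩ := eigenvalue_mem_ball hev
    refine ⟨k, ?_⟩
    rw [Metric.mem_closedBall, Real.dist_eq] at hk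
    have h1 := Finset.add_sum_erase Finset.univ (fun j => |cov[Z k, Z j; P]|) (Finset.mem_univ k)
    rw [← h1]
    have h2 : |w i| ≤ |S k k| + |w i - S k k| := by
      calc |w i| = |S k k + (w i - S k k)| := by ring_nf
        _ ≤ _ := abs_add_le _ _
    exact h2.trans (add_le_add le_rfl hk)
  · intro c b t
    have h1 := charFun_map_sum_sq hYg hY0 hind c b t
    simp_rw [hvar] at h1
    rw [← h1, htr]
    congr 2
    ext ω
    rw [← hnorm fun i => Z i ω]

/-- Central limit theorem for sums of squares of Gaussian vectors. -/
theorem tendstoInDistribution_sum_sq [IsProbabilityMeasure P]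
    {ι : ℕ → Type} [∀ n, Fintype (ι n)] {Z : (n : ℕ) → ι n → Ω → ℝ}
    (hZ : ∀ n, HasGaussianLaw (fun ω i => Z n i ω) P) (h0 : ∀ n i, ∫ ω, Z n i ω ∂P = 0)
    {c b : ℕ → ℝ} {v : ℝ}
    (hb : Tendsto b atTop (𝓝 0))
    (hvar : Tendsto (fun n => 2 * (c n ^ 2 * ∑ i, ∑ j, cov[Z n i, Z n j; P] ^ 2)) atTop (𝓝 v))
    (hmax : ∀ δ > 0, ∀ᶠ n in atTop, ∀ i, |c n| * ∑ j, |cov[Z n i, Z n j; P]| < δ)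
    {W : ℕ → Ω → ℝ} (hWm : ∀ n, AEMeasurable (W n) P)
    (hW : ∀ᶠ n in atTop, W n =
      fun ω => c n * (∑ i, Z n i ω ^ 2 - ∑ i, cov[Z n i, Z n i; P]) + b n) :
    TendstoInDistribution W atTop (id : ℝ → ℝ) (fun _ => P) (gaussianReal 0 v.toNNReal) where
  forall_aemeasurable := hWm
  tendsto := by
    -- By Lévy's continuity theorem it suffices to treat characteristic functions. The weights at
    -- frequency `t` have squares summing to t² v / 2 in the limit, which gives exp(-t² v / 2).
    refine ProbabilityMeasure.tendsto_iff_tendsto_charFun.2 fun t => ?_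
    simp only [ProbabilityMeasure.coe_mk, Measure.map_id]
    choose w hw1 hw2 hw3 using fun n => exists_weights_charFun_sum_sq (hZ n) (h0 n)
    have hv : 0 ≤ v := ge_of_tendsto' hvar fun n => by positivity
    have hs : Tendsto (fun n => ∑ i, (t * (c n * w n i)) ^ 2) atTop (𝓝 (t ^ 2 / 2 * v)) := by
      refine (hvar.const_mul (t ^ 2 / 2)).congr fun n => ?_
      rw [← hw1]
      simp_rw [mul_pow, ← Finset.mul_sum]
      ring
    have hm : ∀ δ > 0, ∀ᶠ n in atTop, ∀ i, |t * (c n * w n i)| < δ := by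
      intro δ hδ
      have hδ' : 0 < δ / (|t| + 1) := by positivity
      filter_upwards [hmax _ hδ'] with n hn i
      obtain ⟨j, hj⟩ := hw2 n i
      have h1 : |c n| * |w n i| < δ / (|t| + 1) :=
        (mul_le_mul_of_nonneg_left hj (abs_nonneg _)).trans_lt (hn j)
      rw [abs_mul, abs_mul]
      calc |t| * (|c n| * |w n i|) ≤ |t| * (δ / (|t| + 1)) := by gcongr
        _ < (|t| + 1) * (δ / (|t| + 1)) := by gcongr; linarith
        _ = δ := by field_simp
    have h1 := tendsto_prod_centeredChiSqCharFun hs hm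
    have h2 : Tendsto (fun n => Complex.exp (t * b n * Complex.I)) atTop (𝓝 1) := by
      have hc : Continuous fun x : ℝ => Complex.exp (t * x * Complex.I) := by fun_prop
      simpa [Function.comp_def] using (hc.tendsto 0).comp hb
    have h3 := h2.mul h1
    rw [charFun_gaussianReal]
    convert! h3.congr' ?_ using 2
    · rw [one_mul]
      congr 1
      simp only [Complex.ofReal_zero, mul_zero, zero_mul, zero_sub, Real.coe_toNNReal _ hv]
      push_cast; ring
    · filter_upwards [hW] with n hn
      rw [hn, hw3]

end

/-! ### Second differences as averages of derivatives. -/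

/-- The uniform probability measure on the unit interval. -/
noncomputable abbrev unif : Measure ℝ := volume.restrict (Ioc 0 1)

instance isProbabilityMeasure_unif : IsProbabilityMeasure unif :=
  ⟨by simp [unif]⟩

lemma integral_unif (f : ℝ → ℝ) : ∫ x, f x ∂unif = ∫ x in (0 : ℝ)..1, f x :=
  (intervalIntegral.integral_of_le zero_le_one).symm

lemma ae_unif_mem : ∀ᵐ x ∂unif, x ∈ Ioo (0 : ℝ) 1 := by
  have : unif = volume.restrict (Ioo (0 : ℝ) 1) := Measure.restrict_congr_set Ioo_ae_eq_Ioc.symm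
  rw [this]
  exact ae_restrict_mem measurableSet_Ioo

lemma ae_unif_prod_mem : ∀ᵐ p ∂(unif.prod unif), p.1 ∈ Ioo (0 : ℝ) 1 ∧ p.2 ∈ Ioo (0 : ℝ) 1 := by
  filter_upwards [Measure.quasiMeasurePreserving_fst.ae ae_unif_mem,
    Measure.quasiMeasurePreserving_snd.ae ae_unif_mem] with p h1 h2 using ⟨h1, h2⟩

/-- The uniform probability measure on the unit cube of dimension four. -/
noncomputable abbrev cube : Measure ((ℝ × ℝ) × (ℝ × ℝ)) := (unif.prod unif).prod (unif.prod unif)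

lemma ae_cube_mem : ∀ᵐ p ∂cube, (p.1.1 ∈ Ioo (0 : ℝ) 1 ∧ p.1.2 ∈ Ioo (0 : ℝ) 1) ∧
    p.2.1 ∈ Ioo (0 : ℝ) 1 ∧ p.2.2 ∈ Ioo (0 : ℝ) 1 := by
  filter_upwards [Measure.quasiMeasurePreserving_fst.ae ae_unif_prod_mem,
    Measure.quasiMeasurePreserving_snd.ae ae_unif_prod_mem] with p h1 h2 using ⟨h1, h2⟩

/-- A second order difference is an average of the second derivative, which may be singular at the
end points. -/
lemma second_difference {G G₁ G₂ : ℝ → ℝ} {c h : ℝ} (hh : 0 < h)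
    (hG : ContinuousOn G (Icc (c - h) (c + h)))
    (h1 : ∀ x ∈ Ioo (c - h) (c + h), HasDerivAt G (G₁ x) x)
    (h2 : ∀ x ∈ Ioo (c - h) (c + h), HasDerivAt G₁ (G₂ x) x)
    (hloc : ∀ a b, c - h < a → a ≤ b → b < c + h → IntervalIntegrable G₂ volume a b)
    (hint : Integrable (fun p : ℝ × ℝ => G₂ (c + h * (p.1 - p.2))) (unif.prod unif)) :
    G (c + h) + G (c - h) - 2 * G c =
      h ^ 2 * ∫ p, G₂ (c + h * (p.1 - p.2)) ∂(unif.prod unif) := by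
  -- The second difference is H(1) - H(0). Two uses of the fundamental theorem of calculus, one for
  -- `H` and one for the difference of `G₁` inside H', give the double average; only interior
  -- derivatives and integrability are needed.
  set H : ℝ → ℝ := fun x => G (c + h * x) - G (c + h * x - h)
  set H' : ℝ → ℝ := fun x => h * (h * ∫ y, G₂ (c + h * (x - y)) ∂unif) with hH'
  have hHc : ContinuousOn H (Icc 0 1) := by
    refine ContinuousOn.sub (hG.comp (by fun_prop) fun x hx => ?_)
      (hG.comp (by fun_prop) fun x hx => ?_)
    · constructor <;> nlinarith [hx.1, hx.2]
    · constructor <;> nlinarith [hx.1, hx.2]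
  have hH'd : ∀ x ∈ Ioo (0 : ℝ) 1, HasDerivAt H (H' x) x := by
    intro x hx
    have m1 : c + h * x ∈ Ioo (c - h) (c + h) := by constructor <;> nlinarith [hx.1, hx.2]
    have m2 : c + h * x - h ∈ Ioo (c - h) (c + h) := by constructor <;> nlinarith [hx.1, hx.2]
    have hl : HasDerivAt (fun x => c + h * x) h x := by
      simpa using ((hasDerivAt_id x).const_mul h).const_add c
    have d1 : HasDerivAt (fun x => G (c + h * x)) (G₁ (c + h * x) * h) x := (h1 _ m1).comp x hl
    have d2 : HasDerivAt (fun x => G (c + h * x - h)) (G₁ (c + h * x - h) * h) x :=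
      (h1 _ m2).comp x (hl.sub_const h)
    have hsub : uIcc (c + h * x - h) (c + h * x) ⊆ Ioo (c - h) (c + h) := by
      rw [uIcc_of_le (by linarith)]
      exact Icc_subset_Ioo m2.1 m1.2
    have ftc := intervalIntegral.integral_eq_sub_of_hasDerivAt (fun y hy => h2 y (hsub hy))
      (hloc _ _ m2.1 (by linarith) m1.2)
    have hcv := intervalIntegral.integral_comp_sub_mul (a := 0) (b := 1) G₂ hh.ne' (c + h * x)
    have : H' x = G₁ (c + h * x) * h - G₁ (c + h * x - h) * h := by
      have e : ∀ y, c + h * (x - y) = c + h * x - h * y := fun y => by ring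
      simp only [hH', integral_unif, e]
      rw [hcv, mul_one, mul_zero, sub_zero, ftc, smul_eq_mul, mul_inv_cancel_left₀ hh.ne']
      ring
    rw [this]
    exact d1.sub d2
  have hH'i : IntervalIntegrable H' volume 0 1 := by
    rw [intervalIntegrable_iff_integrableOn_Ioc_of_le zero_le_one]
    exact (hint.integral_prod_left.const_mul h).const_mul h
  have ftc := intervalIntegral.integral_eq_sub_of_hasDerivAt_of_le zero_le_one hHc hH'd hH'i
  rw [← integral_unif] at ftc
  have e1 : ∫ x, H' x ∂unif = h ^ 2 * ∫ p, G₂ (c + h * (p.1 - p.2)) ∂(unif.prod unif) := by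
    rw [integral_prod _ hint]
    simp only [hH']
    rw [integral_const_mul, integral_const_mul]
    ring
  rw [← e1, ftc]
  simp only [H, mul_one, mul_zero, add_zero]
  ring_nf

/-- The mixed second order difference of a function whose mixed fourth derivative is `D`,
possibly unbounded near the diagonal. -/
lemma mixed_second_difference {R D K : ℝ → ℝ → ℝ} (hD : HasMixedDeriv R D)
    (hR : ContinuousOn (fun p : ℝ × ℝ => R p.1 p.2) (Icc 0 1 ×ˢ Icc 0 1))
    (hKm : Measurable fun p : ℝ × ℝ => K p.1 p.2)
    (hKD : ∀ s t, 0 < t → t < s → s < 1 → D s t = K s t)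
    (hKb : ∀ δ > 0, ∃ M, ∀ s t, δ ≤ s - t → |K s t| ≤ M)
    {s t h : ℝ} (hh : 0 < h) (ht : h ≤ t) (hst : t + 2 * h ≤ s) (hs : s + h ≤ 1)
    (hint : Integrable (fun p : (ℝ × ℝ) × (ℝ × ℝ) =>
      K (s + h * (p.2.1 - p.2.2)) (t + h * (p.1.1 - p.1.2))) cube) :
    delta1 h (delta2 h R) s t =
      h ^ 4 * ∫ p, K (s + h * (p.2.1 - p.2.2)) (t + h * (p.1.1 - p.1.2)) ∂cube := by
  obtain ⟨A, B, E, hABE⟩ := hD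
  have hnhds : ∀ x : ℝ, 0 < x → x < 1 → Ioc (0 : ℝ) 1 ∈ 𝓝 x := fun x h0 h1 => Ioc_mem_nhds h0 h1
  set G₂ : ℝ → ℝ := fun t' => h ^ 2 * ∫ q, K (s + h * (q.1 - q.2)) t' ∂(unif.prod unif) with hG₂
  have hKm1 : ∀ t', Measurable fun x => K x t' := fun t' =>
    hKm.comp (measurable_id.prodMk measurable_const)
  -- For `t'` strictly below `t + h`, the whole interval [s - h, s + h] stays at positive distance
  -- above `t'`, so the difference in the first variable meets only a bounded kernel.
  have inner_eq : ∀ t' ∈ Ioo (t - h) (t + h), B (s + h) t' + B (s - h) t' - 2 * B s t' = G₂ t' := by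
    intro t' ht'
    have hpos : 0 < t' := by linarith [ht'.1]
    have hlt : t' < 1 := by linarith [ht'.2]
    have hmem : ∀ x ∈ Icc (s - h) (s + h), x ∈ Ioc (0 : ℝ) 1 ∧ t' < x := fun x hx =>
      ⟨⟨by linarith [hx.1, ht'.2], by linarith [hx.2]⟩, by linarith [hx.1, ht'.2]⟩
    have hlow : 0 < s - h - t' := by linarith [ht'.2]
    obtain ⟨M, hM⟩ := hKb _ hlow
    refine second_difference (G := fun x => B x t') (G₁ := fun x => E x t')
      (G₂ := fun x => K x t') hh ?_ ?_ ?_ ?_ ?_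
    · intro x hx
      obtain ⟨hx1, hx2⟩ := hmem x hx
      exact ((hABE x hx1 t' ⟨hpos, hlt.le⟩ hx2.ne').2.2.1).continuousWithinAt.mono
        fun y hy => (hmem y hy).1
    · intro x hx
      obtain ⟨hx1, hx2⟩ := hmem x (Ioo_subset_Icc_self hx)
      exact ((hABE x hx1 t' ⟨hpos, hlt.le⟩ hx2.ne').2.2.1).hasDerivAt
        (hnhds x hx1.1 (by linarith [hx.2]))
    · intro x hx
      obtain ⟨hx1, hx2⟩ := hmem x (Ioo_subset_Icc_self hx)
      have := ((hABE x hx1 t' ⟨hpos, hlt.le⟩ hx2.ne').2.2.2).hasDerivAt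
        (hnhds x hx1.1 (by linarith [hx.2]))
      rwa [hKD x t' hpos hx2 (by linarith [hx.2])] at this
    · intro a b ha hab _
      rw [intervalIntegrable_iff_integrableOn_Ioc_of_le hab]
      refine Measure.integrableOn_of_bounded (M := M) (by simp) (hKm1 t').aestronglyMeasurable ?_
      refine (ae_restrict_mem measurableSet_Ioc).mono fun x hx => ?_
      exact hM x t' (by linarith [hx.1])
    · refine Integrable.of_bound (C := M)
        ((hKm1 t').comp (by fun_prop)).aestronglyMeasurable ?_
      filter_upwards [ae_unif_prod_mem] with p hp
      refine hM _ _ ?_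
      nlinarith [hp.1.1, hp.2.2]
  have hG₂m : StronglyMeasurable G₂ := by
    have : Measurable fun z : ℝ × (ℝ × ℝ) => K (s + h * (z.2.1 - z.2.2)) z.1 :=
      hKm.comp (by fun_prop : Measurable fun z : ℝ × (ℝ × ℝ) => (s + h * (z.2.1 - z.2.2), z.1))
    exact (this.stronglyMeasurable.integral_prod_right').const_mul _
  -- In the second variable the derivative may blow up at `t + h`, when s = t + 2h. The global
  -- integrability `hint` is what controls that end point.
  have outer := second_difference (c := t)
    (G := fun t' => R (s + h) t' + R (s - h) t' - 2 * R s t')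
    (G₁ := fun t' => A (s + h) t' + A (s - h) t' - 2 * A s t') (G₂ := G₂) hh ?_ ?_ ?_ ?_ ?_
  · have e1 : delta1 h (delta2 h R) s t = R (s + h) (t + h) + R (s - h) (t + h) - 2 * R s (t + h)
        + (R (s + h) (t - h) + R (s - h) (t - h) - 2 * R s (t - h))
        - 2 * (R (s + h) t + R (s - h) t - 2 * R s t) := by
      simp only [delta1, delta2]; ring
    rw [e1, outer, integral_prod _ hint]
    simp only [hG₂]
    rw [integral_const_mul]
    ring
  · have hc : ∀ x ∈ Icc (0 : ℝ) 1, ContinuousOn (fun t' => R x t') (Icc (t - h) (t + h)) := by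
      intro x hx
      exact hR.comp (f := fun t' : ℝ => (x, t')) (by fun_prop)
        fun y hy => ⟨hx, by linarith [hy.1], by linarith [hy.2]⟩
    exact ((hc _ ⟨by linarith, hs⟩).add (hc _ ⟨by linarith, by linarith⟩)).sub
      ((hc s ⟨by linarith, by linarith⟩).const_mul 2)
  · intro x hx
    have hx0 : 0 < x := by linarith [hx.1]
    have hx1 : x < 1 := by linarith [hx.2]
    have hd : ∀ y ∈ Icc (s - h) (s + h), HasDerivAt (fun u => R y u) (A y x) x := fun y hy =>
      ((hABE y ⟨by linarith [hy.1, hx.2], by linarith [hy.2]⟩ x ⟨hx0, hx1.le⟩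
        (by linarith [hy.1, hx.2] : x < y).ne').1).hasDerivAt (hnhds x hx0 hx1)
    exact ((hd _ ⟨by linarith, le_rfl⟩).add (hd _ ⟨le_rfl, by linarith⟩)).sub
      ((hd s ⟨by linarith, by linarith⟩).const_mul 2)
  · intro x hx
    have hx0 : 0 < x := by linarith [hx.1]
    have hx1 : x < 1 := by linarith [hx.2]
    have hd : ∀ y ∈ Icc (s - h) (s + h), HasDerivAt (fun u => A y u) (B y x) x := fun y hy =>
      ((hABE y ⟨by linarith [hy.1, hx.2], by linarith [hy.2]⟩ x ⟨hx0, hx1.le⟩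
        (by linarith [hy.1, hx.2] : x < y).ne').2.1).hasDerivAt (hnhds x hx0 hx1)
    rw [← inner_eq x hx]
    exact ((hd _ ⟨by linarith, le_rfl⟩).add (hd _ ⟨le_rfl, by linarith⟩)).sub
      ((hd s ⟨by linarith, by linarith⟩).const_mul 2)
  · intro a b _ hab hb
    rw [intervalIntegrable_iff_integrableOn_Ioc_of_le hab]
    have hlow : 0 < s - h - b := by linarith
    obtain ⟨M, hM⟩ := hKb _ hlow
    refine Measure.integrableOn_of_bounded (M := h ^ 2 * M) (by simp)
      hG₂m.aestronglyMeasurable ?_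
    refine (ae_restrict_mem measurableSet_Ioc).mono fun x hx => ?_
    simp only [hG₂, norm_mul, norm_pow, Real.norm_eq_abs, sq_abs]
    gcongr
    have := norm_integral_le_of_norm_le_const (μ := unif.prod unif) (C := M)
      (f := fun q : ℝ × ℝ => K (s + h * (q.1 - q.2)) x) ?_
    · simpa using this
    · filter_upwards [ae_unif_prod_mem] with p hp
      refine hM _ _ ?_
      nlinarith [hp.1.1, hp.2.2, hx.2]
  · exact hint.integral_prod_left.const_mul _

/-! ### The kernel integrals ρ_γ. -/

/-- The difference `v - y` of the variables of `rho₂`, in coordinates on the unit cube. -/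
def gap (l : ℝ) (p : (ℝ × ℝ) × (ℝ × ℝ)) : ℝ := l + p.2.1 - p.2.2 - p.1.1 + p.1.2

lemma measurable_gap (l : ℝ) : Measurable (gap l) := by
  unfold gap; fun_prop

lemma sub_two_le_gap {l : ℝ} {p : (ℝ × ℝ) × (ℝ × ℝ)}
    (hp : (p.1.1 ∈ Ioo (0 : ℝ) 1 ∧ p.1.2 ∈ Ioo (0 : ℝ) 1) ∧
      p.2.1 ∈ Ioo (0 : ℝ) 1 ∧ p.2.2 ∈ Ioo (0 : ℝ) 1) : l - 2 < gap l p := by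
  obtain ⟨⟨h1, h2⟩, h3, h4⟩ := hp
  unfold gap
  linarith [h1.2, h2.1, h3.1, h4.2]

lemma integrable_rpow_neg_unif {a : ℝ} (ha : a < 1) : Integrable (fun x => x ^ (-a)) unif :=
  (intervalIntegrable_iff_integrableOn_Ioc_of_le zero_le_one).1
    (intervalIntegral.intervalIntegrable_rpow' (by linarith))

lemma integrable_one_sub_rpow_neg_unif {a : ℝ} (ha : a < 1) :
    Integrable (fun x => (1 - x) ^ (-a)) unif := by
  have h := (intervalIntegral.intervalIntegrable_rpow' (a := 0) (b := 1)
    (show -1 < -a by linarith)).comp_sub_left 1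
  simp only [sub_zero, sub_self] at h
  exact (intervalIntegrable_iff_integrableOn_Ioc_of_le zero_le_one).1 h.symm

/-- The gap is l - 2 plus the four nonnegative terms 1 - p.1.1, p.1.2, p.2.1 and 1 - p.2.2, hence at
least their geometric mean by the weighted arithmetic-geometric inequality. This splits the
singularity into four one-variable powers of exponent a/4. -/
lemma gap_rpow_neg_le {a l : ℝ} (ha : 0 ≤ a) (hl : 2 ≤ l) {p : (ℝ × ℝ) × (ℝ × ℝ)}
    (hp : (p.1.1 ∈ Ioo (0 : ℝ) 1 ∧ p.1.2 ∈ Ioo (0 : ℝ) 1) ∧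
      p.2.1 ∈ Ioo (0 : ℝ) 1 ∧ p.2.2 ∈ Ioo (0 : ℝ) 1) :
    gap l p ^ (-a) ≤ ((1 - p.1.1) ^ (-(a / 4)) * p.1.2 ^ (-(a / 4))) *
      (p.2.1 ^ (-(a / 4)) * (1 - p.2.2) ^ (-(a / 4))) := by
  obtain ⟨⟨h1, h2⟩, h3, h4⟩ := hp
  have k1 : 0 < 1 - p.1.1 := by linarith [h1.2]
  have k4 : 0 < 1 - p.2.2 := by linarith [h4.2]
  have k2 := h2.1
  have k3 := h3.1
  set b := (1 - p.1.1) ^ (1 / 4 : ℝ) * p.1.2 ^ (1 / 4 : ℝ) * p.2.1 ^ (1 / 4 : ℝ) *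
    (1 - p.2.2) ^ (1 / 4 : ℝ) with hb
  have hbpos : 0 < b := by positivity
  have amgm := Real.geom_mean_le_arith_mean4_weighted (w₁ := 1 / 4) (w₂ := 1 / 4) (w₃ := 1 / 4)
    (w₄ := 1 / 4) (by norm_num) (by norm_num) (by norm_num) (by norm_num) k1.le k2.le k3.le k4.le
    (by norm_num)
  have hbg : b ≤ gap l p := by
    unfold gap
    linarith
  calc gap l p ^ (-a) ≤ b ^ (-a) := Real.rpow_le_rpow_of_nonpos hbpos hbg (by linarith)
    _ = _ := by
      rw [hb, Real.mul_rpow (by positivity) (by positivity),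
        Real.mul_rpow (by positivity) (by positivity), Real.mul_rpow (by positivity) (by positivity),
        ← Real.rpow_mul k1.le, ← Real.rpow_mul k2.le, ← Real.rpow_mul k3.le, ← Real.rpow_mul k4.le]
      rw [show 1 / 4 * -a = -(a / 4) by ring]
      ring

/-- The condition a < 4 makes each of the four factors integrable on the unit interval; it covers
the contact lag l = 2. -/
lemma integrable_gap_rpow_neg {a l : ℝ} (ha : 0 ≤ a) (ha4 : a < 4) (hl : 2 ≤ l) :
    Integrable (fun p => gap l p ^ (-a)) cube := by
  have i1 := integrable_rpow_neg_unif (show a / 4 < 1 by linarith)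
  have i2 := integrable_one_sub_rpow_neg_unif (show a / 4 < 1 by linarith)
  refine ((i2.mul_prod i1).mul_prod (i1.mul_prod i2)).mono'
    ((measurable_gap l).pow_const _).aestronglyMeasurable ?_
  filter_upwards [ae_cube_mem] with p hp
  have hpos : 0 < gap l p := by linarith [sub_two_le_gap (l := l) hp]
  rw [Real.norm_of_nonneg (by positivity)]
  exact gap_rpow_neg_le ha hl hp

/-- The average of `(v - y)^{-a}`. -/
noncomputable def gapIntegral (a l : ℝ) : ℝ := ∫ p, gap l p ^ (-a) ∂cube

lemma gapIntegral_nonneg (a : ℝ) {l : ℝ} (hl : 2 ≤ l) : 0 ≤ gapIntegral a l := by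
  refine integral_nonneg_of_ae ?_
  filter_upwards [ae_cube_mem] with p hp
  have hpos : 0 < gap l p := by linarith [sub_two_le_gap (l := l) hp]
  exact Real.rpow_nonneg hpos.le _

lemma gapIntegral_le {a l : ℝ} (ha : 0 ≤ a) (hl : 2 < l) : gapIntegral a l ≤ (l - 2) ^ (-a) := by
  have h := norm_integral_le_of_norm_le_const (μ := cube) (f := fun p => gap l p ^ (-a))
    (C := (l - 2) ^ (-a)) ?_
  · refine (le_abs_self _).trans ?_
    simpa [gapIntegral] using h
  · filter_upwards [ae_cube_mem] with p hp
    have h1 := sub_two_le_gap (l := l) hp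
    rw [Real.norm_of_nonneg (Real.rpow_nonneg (by linarith) _)]
    exact Real.rpow_le_rpow_of_nonpos (by linarith) h1.le (by linarith)

lemma summable_gapIntegral {a : ℝ} (ha : 1 < a) :
    Summable fun l : ℕ => gapIntegral a ((l : ℝ) + 2) := by
  -- The first term, at gap parameter 2, is dropped: there the bound (l - 2)^(-a) is not available.
  rw [← summable_nat_add_iff 1]
  have h : Summable fun l : ℕ => ((l + 1 : ℕ) : ℝ) ^ (-a) :=
    (summable_nat_add_iff 1).2 (Real.summable_nat_rpow.2 (by linarith))
  refine h.of_nonneg_of_le (fun l => gapIntegral_nonneg a ?_) fun l => ?_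
  · have : (0 : ℝ) ≤ ((l + 1 : ℕ) : ℝ) := Nat.cast_nonneg _
    linarith
  · have := gapIntegral_le (a := a) (l := ((l + 1 : ℕ) : ℝ) + 2) (by linarith)
      (by push_cast; linarith [Nat.cast_nonneg (α := ℝ) l])
    simpa using this

/-- The pair p.2 carries the offsets of `u` and `v`, and p.1 those of `x` and `y`. Integrability on
the cube justifies Fubini, whose inner slices are integrable only almost everywhere; hence the
nested almost-everywhere statements. -/
lemma rho_eq_gapIntegral {γ : ℝ} (hγ : γ ∈ Ioo (0 : ℝ) 2) (l : ℕ) (hl : 2 ≤ l) :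
    rho γ l = gapIntegral (2 + γ) l := by
  have hl' : (2 : ℝ) ≤ l := by exact_mod_cast hl
  have hint := integrable_gap_rpow_neg (a := 2 + γ) (l := l) (by linarith [hγ.1])
    (by linarith [hγ.2]) hl'
  have e1 : gapIntegral (2 + γ) l =
      ∫ q, ∫ p, gap l (p, q) ^ (-(2 + γ)) ∂(unif.prod unif) ∂(unif.prod unif) :=
    integral_prod_symm _ hint
  have e2 : ∀ᵐ q ∂(unif.prod unif), ∫ p, gap l (p, q) ^ (-(2 + γ)) ∂(unif.prod unif) =
      ∫ x, ∫ y, gap l ((x, y), q) ^ (-(2 + γ)) ∂unif ∂unif := by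
    filter_upwards [hint.prod_left_ae] with q hq
    exact integral_prod _ hq
  rw [e1, integral_prod _ hint.integral_prod_right]
  have e3 : ∀ᵐ u ∂unif, ∀ᵐ w ∂unif,
      ∫ p, gap l (p, (u, w)) ^ (-(2 + γ)) ∂(unif.prod unif) =
      ∫ x, ∫ y, gap l ((x, y), (u, w)) ^ (-(2 + γ)) ∂unif ∂unif :=
    Measure.ae_ae_of_ae_prod e2
  have e4 : ∫ u, ∫ w, ∫ p, gap l (p, (u, w)) ^ (-(2 + γ)) ∂(unif.prod unif) ∂unif ∂unif =
      ∫ u, ∫ w, ∫ x, ∫ y, gap l ((x, y), (u, w)) ^ (-(2 + γ)) ∂unif ∂unif ∂unif ∂unif := by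
    refine integral_congr_ae ?_
    filter_upwards [e3] with u hu
    exact integral_congr_ae hu
  rw [e4]
  simp only [rho, rho₂, integral_unif]
  have c1 : ∀ f : ℝ → ℝ, ∫ u in (l : ℝ)..(l + 1), f u = ∫ u in (0 : ℝ)..1, f (l + u) := by
    intro f; simp [intervalIntegral.integral_comp_add_left]
  have c2 : ∀ (f : ℝ → ℝ) (u : ℝ), ∫ v in (u - 1)..u, f v = ∫ w in (0 : ℝ)..1, f (u - w) := by
    intro f u; simp [intervalIntegral.integral_comp_sub_left]
  rw [c1]
  simp_rw [c2, zero_add]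
  refine intervalIntegral.integral_congr fun u hu => ?_
  rw [uIcc_of_le zero_le_one] at hu
  refine intervalIntegral.integral_congr fun w hw => ?_
  rw [uIcc_of_le zero_le_one] at hw
  refine intervalIntegral.integral_congr fun x hx => ?_
  rw [uIcc_of_le zero_le_one] at hx
  refine intervalIntegral.integral_congr fun y hy => ?_
  rw [uIcc_of_le zero_le_one] at hy
  rw [show (l : ℝ) + u - w - (x - y) = gap l ((x, y), u, w) by unfold gap; simp only; ring,
    one_div, ← Real.rpow_neg]
  unfold gap
  simp only
  linarith [hu.1, hw.2, hx.2, hy.1]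

lemma rho_add_two_eq {γ : ℝ} (hγ : γ ∈ Ioo (0 : ℝ) 2) (l : ℕ) :
    rho γ (l + 2) = gapIntegral (2 + γ) ((l : ℝ) + 2) := by
  rw [rho_eq_gapIntegral hγ _ (by omega)]
  push_cast; rfl

lemma summable_rho_sq {γ : ℝ} (hγ : γ ∈ Ioo (0 : ℝ) 2) :
    Summable fun l : ℕ => rho γ (l + 2) ^ 2 := by
  have h : Summable fun l : ℕ => rho γ (l + 2) := by
    simp_rw [rho_add_two_eq hγ]
    exact summable_gapIntegral (by linarith [hγ.1])
  have h0 : ∀ᶠ l : ℕ in atTop, rho γ (l + 2) ≤ 1 :=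
    (h.tendsto_atTop_zero.eventually (gt_mem_nhds one_pos)).mono fun _ h => h.le
  refine h.of_norm_bounded_eventually_nat ?_
  filter_upwards [h0] with l hl
  have hnn : 0 ≤ rho γ (l + 2) := by
    rw [rho_add_two_eq hγ]
    exact gapIntegral_nonneg _ (by linarith [Nat.cast_nonneg (α := ℝ) l])
  rw [Real.norm_of_nonneg (sq_nonneg _)]
  nlinarith

/-! ### Normalised covariances at lags at least two. -/

/-- The triangle `{0 ≤ t ≤ s ≤ 1}`. -/
def triangle : Set (ℝ × ℝ) := {p | 0 ≤ p.2 ∧ p.2 ≤ p.1 ∧ p.1 ≤ 1}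

lemma isCompact_triangle : IsCompact triangle := by
  refine (isCompact_Icc.prod isCompact_Icc : IsCompact (Icc (0 : ℝ) 1 ×ˢ Icc (0 : ℝ) 1)).of_isClosed_subset
    ?_ fun p hp => ⟨⟨hp.1.trans hp.2.1, hp.2.2⟩, hp.1, hp.2.1.trans hp.2.2⟩
  exact (isClosed_le continuous_const continuous_snd).inter
    ((isClosed_le continuous_snd continuous_fst).inter
      (isClosed_le continuous_fst continuous_const))

noncomputable section

/-- The function `L`, set to zero outside `]0, 1]`. -/
def truncL (L : ℝ → ℝ) : ℝ → ℝ := (Ioc (0 : ℝ) 1).indicator L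

/-- The function `C`, set to zero outside the triangle. -/
def truncC (C : ℝ → ℝ → ℝ) : ℝ × ℝ → ℝ := triangle.indicator fun p => C p.1 p.2

/-- The explicit form `L(s - t) C(s, t) (s - t)^{-(2+γ)}` of the mixed fourth derivative. -/
def kern (γ : ℝ) (L : ℝ → ℝ) (C : ℝ → ℝ → ℝ) (s t : ℝ) : ℝ :=
  truncL L (s - t) * truncC C (s, t) * (s - t) ^ (-(2 + γ))

/-- The normalised mixed second order difference. -/
def normDelta (γ : ℝ) (L : ℝ → ℝ) (R : ℝ → ℝ → ℝ) (h s t : ℝ) : ℝ :=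
  delta1 h (delta2 h R) s t / (h ^ (2 - γ) * L h)

end

variable {γ : ℝ} {L : ℝ → ℝ} {C : ℝ → ℝ → ℝ}

lemma truncL_nonneg (hL : IsSlowlyVarying L) (x : ℝ) : 0 ≤ truncL L x :=
  indicator_nonneg (fun y hy => (hL.pos y hy).le) x

lemma measurable_truncC
    (hC : ContinuousOn (fun p : ℝ × ℝ => C p.1 p.2) triangle) : Measurable (truncC C) := by
  refine measurable_of_restrict_of_restrict_compl (s := triangle)
    isCompact_triangle.isClosed.measurableSet ?_ ?_
  · convert! (continuousOn_iff_continuous_domRestrict.1 hC).measurable using 1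
    funext x
    exact indicator_of_mem (s := triangle) x.2 fun p => C p.1 p.2
  · convert! (measurable_const : Measurable fun _ : ↥triangleᶜ => (0 : ℝ)) using 1
    funext x
    exact indicator_of_notMem (s := triangle) x.2 fun p => C p.1 p.2

lemma exists_truncC_bound
    (hC : ContinuousOn (fun p : ℝ × ℝ => C p.1 p.2) triangle) :
    ∃ M, 0 ≤ M ∧ ∀ p, |truncC C p| ≤ M := by
  obtain ⟨M, hM⟩ := isCompact_triangle.exists_bound_of_continuousOn hC
  refine ⟨max M 0, le_max_right _ _, fun p => ?_⟩
  unfold truncC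
  by_cases hp : p ∈ triangle
  · rw [indicator_of_mem hp]
    exact (hM p hp).trans (le_max_left _ _)
  · rw [indicator_of_notMem hp]
    simp

lemma measurable_kern (hL : IsSlowlyVarying L)
    (hC : ContinuousOn (fun p : ℝ × ℝ => C p.1 p.2) triangle) :
    Measurable fun p : ℝ × ℝ => kern γ L C p.1 p.2 := by
  have h1 : Measurable fun p : ℝ × ℝ => truncL L (p.1 - p.2) :=
    hL.measurable_indicator.comp (by fun_prop)
  have h2 : Measurable fun p : ℝ × ℝ => (p.1 - p.2) ^ (-(2 + γ)) := by fun_prop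
  exact (h1.mul (measurable_truncC hC)).mul h2

lemma eq_kern {D : ℝ → ℝ → ℝ} (hL : IsSlowlyVarying L)
    (hDC : ∀ s t : ℝ, 0 < t → t < s → s < 1 → (s - t) ^ (2 + γ) / L (s - t) * D s t = C s t)
    {s t : ℝ} (ht : 0 < t) (hts : t < s) (hs : s < 1) : D s t = kern γ L C s t := by
  have hd : 0 < s - t := sub_pos.2 hts
  have hm : s - t ∈ Ioc (0 : ℝ) 1 := ⟨hd, by linarith⟩
  have hLp := hL.pos _ hm
  have hT : (s, t) ∈ triangle := ⟨ht.le, hts.le, hs.le⟩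
  have hp : 0 < (s - t) ^ (2 + γ) := Real.rpow_pos_of_pos hd _
  unfold kern truncL truncC
  rw [indicator_of_mem hm, indicator_of_mem hT, ← hDC s t ht hts hs, Real.rpow_neg hd.le]
  field_simp

lemma exists_kern_bound (hγ : 0 < γ) (hL : IsSlowlyVarying L)
    (hLbdd : ∀ δ : ℝ, 0 < δ → BddAbove (L '' Icc δ 1))
    (hC : ContinuousOn (fun p : ℝ × ℝ => C p.1 p.2) triangle) {δ : ℝ} (hδ : 0 < δ) :
    ∃ M, ∀ s t, δ ≤ s - t → |kern γ L C s t| ≤ M := by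
  obtain ⟨M, hM0, hM⟩ := exists_truncC_bound hC
  obtain ⟨B, hB⟩ := hLbdd δ hδ
  refine ⟨max B 0 * M * δ ^ (-(2 + γ)), fun s t hst => ?_⟩
  have hd : 0 < s - t := hδ.trans_le hst
  unfold kern
  rw [abs_mul, abs_mul, abs_of_nonneg (truncL_nonneg hL _), abs_of_nonneg (by positivity : 0 ≤ (s - t) ^ (-(2 + γ)))]
  have h1 : truncL L (s - t) ≤ max B 0 := by
    unfold truncL
    by_cases hm : s - t ∈ Ioc (0 : ℝ) 1
    · rw [indicator_of_mem hm]
      exact (hB ⟨_, ⟨hst, hm.2⟩, rfl⟩).trans (le_max_left _ _)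
    · rw [indicator_of_notMem hm]
      exact le_max_right _ _
  have h2 : (s - t) ^ (-(2 + γ)) ≤ δ ^ (-(2 + γ)) :=
    Real.rpow_le_rpow_of_nonpos hδ hst (by linarith)
  have h3 := hM (s, t)
  gcongr

/-- Truncation extends the Potter bound to every r > 0, since the ratio vanishes once h r > 1. -/
lemma exists_truncL_div_bound (hL : IsSlowlyVarying L)
    (hLbdd : ∀ δ : ℝ, 0 < δ → BddAbove (L '' Icc δ 1)) {ε : ℝ} (hε : 0 < ε) :
    ∃ A > 0, ∃ h₀ > (0 : ℝ), h₀ ≤ 1 ∧ ∀ h ∈ Ioc 0 h₀, ∀ r > 0,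
      truncL L (h * r) / L h ≤ A * (r ^ ε + r ^ (-ε)) := by
  obtain ⟨A, hA, h₀, hh₀, hle, H⟩ := hL.potter hLbdd hε
  refine ⟨A, hA, h₀, hh₀, hle, fun h hh r hr => ?_⟩
  unfold truncL
  by_cases hm : h * r ∈ Ioc (0 : ℝ) 1
  · rw [indicator_of_mem hm]
    have := H h hh _ hm
    rwa [mul_div_cancel_left₀ _ hh.1.ne', Real.inv_rpow hr.le, ← Real.rpow_neg hr.le] at this
  · rw [indicator_of_notMem hm, zero_div]
    positivity

lemma tendsto_truncL_div (hL : IsSlowlyVarying L) {r : ℝ} (hr : 0 < r) :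
    Tendsto (fun h => truncL L (h * r) / L h) (𝓝[>] 0) (𝓝 1) := by
  refine (hL.tendsto r hr).congr' ?_
  have : Ioo (0 : ℝ) (1 / r) ∈ 𝓝[>] (0 : ℝ) := Ioo_mem_nhdsGT (by positivity)
  filter_upwards [this] with h hh
  have hm : h * r ∈ Ioc (0 : ℝ) 1 := ⟨mul_pos hh.1 hr, ((lt_div_iff₀ hr).1 hh.2).le⟩
  unfold truncL
  rw [indicator_of_mem hm, mul_comm]

lemma rpow_add_rpow_mul {r ε a : ℝ} (hr : 0 < r) :
    (r ^ ε + r ^ (-ε)) * r ^ (-a) = r ^ (-(a - ε)) + r ^ (-(a + ε)) := by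
  rw [add_mul, ← Real.rpow_add hr, ← Real.rpow_add hr]
  ring_nf

/-- The point of the triangle at which `C` is evaluated in the difference at `(t + l h, t)`. -/
def samplePoint (l h t : ℝ) (p : (ℝ × ℝ) × (ℝ × ℝ)) : ℝ × ℝ :=
  (t + l * h + h * (p.2.1 - p.2.2), t + h * (p.1.1 - p.1.2))

/-- The integrand of the normalised difference at `(t + l h, t)`. -/
noncomputable def normKern (γ : ℝ) (L : ℝ → ℝ) (C : ℝ → ℝ → ℝ) (l h t : ℝ)
    (p : (ℝ × ℝ) × (ℝ × ℝ)) : ℝ :=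
  truncL L (h * gap l p) / L h * truncC C (samplePoint l h t p) * gap l p ^ (-(2 + γ))

lemma measurable_truncL_gap (hL : IsSlowlyVarying L) (l h : ℝ) :
    Measurable fun p => truncL L (h * gap l p) / L h :=
  (hL.measurable_indicator.comp ((measurable_gap l).const_mul h)).div_const _

lemma measurable_truncC_samplePoint
    (hC : ContinuousOn (fun p : ℝ × ℝ => C p.1 p.2) triangle) (l h t : ℝ) :
    Measurable fun p => truncC C (samplePoint l h t p) :=
  (measurable_truncC hC).comp (by unfold samplePoint; fun_prop)

lemma measurable_normKern (hL : IsSlowlyVarying L)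
    (hC : ContinuousOn (fun p : ℝ × ℝ => C p.1 p.2) triangle) (l h t : ℝ) :
    Measurable (normKern γ L C l h t) :=
  ((measurable_truncL_gap hL l h).mul (measurable_truncC_samplePoint hC l h t)).mul
    ((measurable_gap l).pow_const _)

/-- A bound on the normalised kernel, uniform in the step. -/
lemma exists_normKern_bound (hL : IsSlowlyVarying L)
    (hLbdd : ∀ δ : ℝ, 0 < δ → BddAbove (L '' Icc δ 1))
    (hC : ContinuousOn (fun p : ℝ × ℝ => C p.1 p.2) triangle) {ε : ℝ} (hε : 0 < ε) :
    ∃ A ≥ 0, ∃ h₀ > (0 : ℝ), h₀ ≤ 1 ∧ ∀ h ∈ Ioc 0 h₀, ∀ l, 2 ≤ l → ∀ t, ∀ᵐ p ∂cube,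
      ‖normKern γ L C l h t p‖ ≤
        A * (gap l p ^ (-(2 + γ - ε)) + gap l p ^ (-(2 + γ + ε))) := by
  obtain ⟨A, hA, h₀, hh₀, hle, H⟩ := exists_truncL_div_bound hL hLbdd hε
  obtain ⟨M, hM0, hM⟩ := exists_truncC_bound hC
  refine ⟨A * M, by positivity, h₀, hh₀, hle, fun h hh l hl t => ?_⟩
  filter_upwards [ae_cube_mem] with p hp
  have hpos : 0 < gap l p := by linarith [sub_two_le_gap (l := l) hp]
  have hLh := hL.pos h ⟨hh.1, hh.2.trans hle⟩
  have h1 := H h hh _ hpos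
  have h2 := hM (samplePoint l h t p)
  rw [← rpow_add_rpow_mul hpos, normKern, norm_mul, norm_mul,
    Real.norm_of_nonneg (div_nonneg (truncL_nonneg hL _) hLh.le),
    Real.norm_of_nonneg (Real.rpow_nonneg hpos.le _), Real.norm_eq_abs]
  calc _ ≤ A * (gap l p ^ ε + gap l p ^ (-ε)) * M * gap l p ^ (-(2 + γ)) := by gcongr
    _ = _ := by ring

/-- The two coordinates of the sample point differ by exactly h times the gap, so the power of h
factors out and L is compared at h · gap and at h. -/
lemma kern_samplePoint {l h t : ℝ} (hh : 0 < h) (hLh : 0 < L h) {p : (ℝ × ℝ) × (ℝ × ℝ)}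
    (hpos : 0 < gap l p) :
    kern γ L C (samplePoint l h t p).1 (samplePoint l h t p).2 =
      (h ^ (-(2 + γ)) * L h) * normKern γ L C l h t p := by
  have hd : (samplePoint l h t p).1 - (samplePoint l h t p).2 = h * gap l p := by
    unfold samplePoint gap
    simp only
    ring
  unfold kern normKern
  rw [hd, Real.mul_rpow hh.le hpos.le]
  field_simp

/-- The normalised difference as an integral over the cube, with a bound uniform in the step. -/
lemma normDelta_eq_integral {R D : ℝ → ℝ → ℝ} (hD : HasMixedDeriv R D)
    (hR : ContinuousOn (fun p : ℝ × ℝ => R p.1 p.2) (Icc 0 1 ×ˢ Icc 0 1))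
    (hγ : γ ∈ Ioo (0 : ℝ) 2) (hL : IsSlowlyVarying L)
    (hLbdd : ∀ δ : ℝ, 0 < δ → BddAbove (L '' Icc δ 1))
    (hC : ContinuousOn (fun p : ℝ × ℝ => C p.1 p.2) triangle)
    (hDC : ∀ s t : ℝ, 0 < t → t < s → s < 1 → (s - t) ^ (2 + γ) / L (s - t) * D s t = C s t) :
    ∃ h₀ > (0 : ℝ), h₀ ≤ 1 ∧ ∃ b : ℕ → ℝ, Summable b ∧ (∀ l, 0 ≤ b l) ∧
      ∀ h ∈ Ioc 0 h₀, ∀ l : ℕ, 2 ≤ l → ∀ t, h ≤ t → t + (l + 1) * h ≤ 1 →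
        Integrable (normKern γ L C l h t) cube ∧
        normDelta γ L R h (t + l * h) t = ∫ p, normKern γ L C l h t p ∂cube ∧
        |normDelta γ L R h (t + l * h) t| ≤ b l := by
  -- With this `ε` the exponents 2 + γ ± ε equal 3 + γ/2 and 1 + 3γ/2. Both lie between 1, for
  -- summability over lags, and 4, for integrability on the cube.
  set ε := (2 - γ) / 2 with hεdef
  have hε : 0 < ε := by have := hγ.2; simp only [hεdef]; linarith
  have hp1 : 1 < 2 + γ - ε := by have := hγ.1; simp only [hεdef]; linarith
  have hp1' : 2 + γ - ε < 4 := by have := hγ.2; simp only [hεdef]; linarith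
  have hp2 : 1 < 2 + γ + ε := by linarith
  have hp2' : 2 + γ + ε < 4 := by have := hγ.2; simp only [hεdef]; linarith
  obtain ⟨A, hA, h₀, hh₀, hle, H⟩ := exists_normKern_bound (γ := γ) hL hLbdd hC hε
  have hlr : ∀ l : ℕ, 2 ≤ l → (2 : ℝ) ≤ l := fun l hl => by exact_mod_cast hl
  set b : ℕ → ℝ := fun l => if 2 ≤ l then
    A * (gapIntegral (2 + γ - ε) l + gapIntegral (2 + γ + ε) l) else 0 with hb
  refine ⟨h₀, hh₀, hle, b, ?_, fun l => ?_, fun h hh l hl t ht htl => ?_⟩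
  · rw [← summable_nat_add_iff 2]
    refine (((summable_gapIntegral hp1).add (summable_gapIntegral hp2)).mul_left A).congr
      fun l => ?_
    simp [hb]
  · simp only [hb]
    split_ifs with hl
    · exact mul_nonneg hA (add_nonneg (gapIntegral_nonneg _ (hlr l hl))
        (gapIntegral_nonneg _ (hlr l hl)))
    · exact le_rfl
  · have i1 := integrable_gap_rpow_neg (a := 2 + γ - ε) (by linarith) hp1' (hlr l hl)
    have i2 := integrable_gap_rpow_neg (a := 2 + γ + ε) (by linarith) hp2' (hlr l hl)
    have ib := (i1.add i2).const_mul A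
    have hint : Integrable (normKern γ L C l h t) cube :=
      ib.mono' (measurable_normKern hL hC l h t).aestronglyMeasurable (H h hh l (hlr l hl) t)
    have hLh := hL.pos h ⟨hh.1, hh.2.trans hle⟩
    have hae : (fun p => kern γ L C (samplePoint l h t p).1 (samplePoint l h t p).2) =ᵐ[cube]
        fun p => (h ^ (-(2 + γ)) * L h) * normKern γ L C l h t p := by
      filter_upwards [ae_cube_mem] with p hp
      have hlr := hlr l hl
      exact kern_samplePoint hh.1 hLh (by linarith [sub_two_le_gap (l := (l : ℝ)) hp])
    have hlh : 2 * h ≤ l * h := mul_le_mul_of_nonneg_right (hlr l hl) hh.1.le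
    have hrep := mixed_second_difference (s := t + l * h) hD hR (measurable_kern hL hC)
      (fun s t h1 h2 h3 => eq_kern hL hDC h1 h2 h3)
      (fun δ hδ => exists_kern_bound hγ.1 hL hLbdd hC hδ) hh.1 ht (by linarith) (by linarith)
      ((hint.const_mul (h ^ (-(2 + γ)) * L h)).congr hae.symm)
    have heq : normDelta γ L R h (t + l * h) t = ∫ p, normKern γ L C l h t p ∂cube := by
      have e1 : ∫ p, kern γ L C (t + l * h + h * (p.2.1 - p.2.2)) (t + h * (p.1.1 - p.1.2)) ∂cube =
          (h ^ (-(2 + γ)) * L h) * ∫ p, normKern γ L C l h t p ∂cube := by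
        rw [← integral_const_mul]
        exact integral_congr_ae hae
      -- The h⁴ of the mixed difference and the scaling of the kernel combine into exactly the
      -- normalising power.
      have hpow : h ^ 4 * h ^ (-(2 + γ)) = h ^ (2 - γ) := by
        rw [← Real.rpow_natCast, ← Real.rpow_add hh.1]
        congr 1; push_cast; ring
      unfold normDelta
      rw [hrep, e1, ← mul_assoc, ← mul_assoc, hpow]
      exact mul_div_cancel_left₀ _ (mul_pos (Real.rpow_pos_of_pos hh.1 _) hLh).ne'
    refine ⟨hint, heq, ?_⟩
    rw [heq, ← Real.norm_eq_abs]
    refine (norm_integral_le_of_norm_le ib (H h hh l (hlr l hl) t)).trans ?_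
    rw [integral_const_mul]
    simp only [hb, if_pos hl, Pi.add_apply]
    rw [integral_add i1 i2]
    rfl

/-- Slow variation gives pointwise convergence of the ratio to 1, and the Potter bound gives an
integrable majorant. The integral does not involve `t`, which later makes the convergence at a fixed
lag uniform in `t`. -/
lemma tendsto_integral_abs_truncL_div_sub_one (hγ : γ ∈ Ioo (0 : ℝ) 2) (hL : IsSlowlyVarying L)
    (hLbdd : ∀ δ : ℝ, 0 < δ → BddAbove (L '' Icc δ 1)) {l : ℝ} (hl : 2 ≤ l) :
    (∀ᶠ h in 𝓝[>] (0 : ℝ), Integrable (fun p =>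
      |truncL L (h * gap l p) / L h - 1| * gap l p ^ (-(2 + γ))) cube) ∧
    Tendsto (fun h => ∫ p, |truncL L (h * gap l p) / L h - 1| * gap l p ^ (-(2 + γ)) ∂cube)
      (𝓝[>] 0) (𝓝 0) := by
  set ε := (2 - γ) / 2 with hεdef
  have hε : 0 < ε := by have := hγ.2; simp only [hεdef]; linarith
  have hp0 : 0 ≤ 2 + γ - ε := by have := hγ.1; simp only [hεdef]; linarith
  have hp1 : 2 + γ - ε < 4 := by have := hγ.2; simp only [hεdef]; linarith
  have hp2 : 2 + γ + ε < 4 := by have := hγ.2; simp only [hεdef]; linarith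
  obtain ⟨A, hA, h₀, hh₀, hle, H⟩ := exists_truncL_div_bound hL hLbdd hε
  have i0 := integrable_gap_rpow_neg (a := 2 + γ) (by linarith) (by linarith) hl
  have i1 := integrable_gap_rpow_neg (a := 2 + γ - ε) hp0 hp1 hl
  have i2 := integrable_gap_rpow_neg (a := 2 + γ + ε) (by linarith) hp2 hl
  have ib := ((i1.add i2).const_mul A).add i0
  have hm : ∀ h, AEStronglyMeasurable (fun p =>
      |truncL L (h * gap l p) / L h - 1| * gap l p ^ (-(2 + γ))) cube := fun h =>
    ((((measurable_truncL_gap hL l h).sub_const 1).abs).mul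
      ((measurable_gap l).pow_const _)).aestronglyMeasurable
  have hbd : ∀ᶠ h in 𝓝[>] (0 : ℝ), ∀ᵐ p ∂cube,
      ‖|truncL L (h * gap l p) / L h - 1| * gap l p ^ (-(2 + γ))‖ ≤
        A * (gap l p ^ (-(2 + γ - ε)) + gap l p ^ (-(2 + γ + ε))) + gap l p ^ (-(2 + γ)) := by
    filter_upwards [Ioc_mem_nhdsGT hh₀] with h hh
    filter_upwards [ae_cube_mem] with p hp
    have hpos : 0 < gap l p := by linarith [sub_two_le_gap (l := l) hp]
    have hLh := hL.pos h ⟨hh.1, hh.2.trans hle⟩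
    have h0 : 0 ≤ truncL L (h * gap l p) / L h := div_nonneg (truncL_nonneg hL _) hLh.le
    have h1 := H h hh _ hpos
    rw [← rpow_add_rpow_mul hpos, norm_mul, Real.norm_of_nonneg (Real.rpow_nonneg hpos.le _),
      Real.norm_of_nonneg (abs_nonneg _)]
    have h2 : |truncL L (h * gap l p) / L h - 1| ≤ A * (gap l p ^ ε + gap l p ^ (-ε)) + 1 := by
      rw [abs_le]; constructor <;> linarith
    calc _ ≤ (A * (gap l p ^ ε + gap l p ^ (-ε)) + 1) * gap l p ^ (-(2 + γ)) := by gcongr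
      _ = _ := by ring
  refine ⟨?_, ?_⟩
  · filter_upwards [hbd] with h hh
    exact ib.mono' (hm h) hh
  · have := tendsto_integral_filter_of_dominated_convergence (μ := cube) (l := 𝓝[>] (0 : ℝ))
      (f := fun _ => (0 : ℝ)) _ (Eventually.of_forall hm) hbd ib ?_
    · simpa using this
    · filter_upwards [ae_cube_mem] with p hp
      have hpos : 0 < gap l p := by linarith [sub_two_le_gap (l := l) hp]
      have := (((tendsto_truncL_div hL hpos).sub_const 1).abs).mul_const (gap l p ^ (-(2 + γ)))
      simpa using this

/-- Uniform convergence of the normalised differences at a fixed lag at least two. -/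
lemma normDelta_tendsto_uniformly {R D : ℝ → ℝ → ℝ} (hD : HasMixedDeriv R D)
    (hR : ContinuousOn (fun p : ℝ × ℝ => R p.1 p.2) (Icc 0 1 ×ˢ Icc 0 1))
    (hγ : γ ∈ Ioo (0 : ℝ) 2) (hL : IsSlowlyVarying L)
    (hLbdd : ∀ δ : ℝ, 0 < δ → BddAbove (L '' Icc δ 1))
    (hC : ContinuousOn (fun p : ℝ × ℝ => C p.1 p.2) triangle)
    (hDC : ∀ s t : ℝ, 0 < t → t < s → s < 1 → (s - t) ^ (2 + γ) / L (s - t) * D s t = C s t)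
    {l : ℕ} (hl : 2 ≤ l) {η : ℝ} (hη : 0 < η) :
    ∀ᶠ h : ℝ in 𝓝[>] 0, ∀ t : ℝ, h ≤ t → t + (l + 1) * h ≤ 1 →
      |normDelta γ L R h (t + l * h) t - rho γ l * C t t| ≤ η := by
  have hlr : (2 : ℝ) ≤ l := by exact_mod_cast hl
  obtain ⟨h₀, hh₀, hle, _, _, _, hrep⟩ := normDelta_eq_integral hD hR hγ hL hLbdd hC hDC
  obtain ⟨M, hM0, hM⟩ := exists_truncC_bound hC
  obtain ⟨hJi, hJ⟩ := tendsto_integral_abs_truncL_div_sub_one hγ hL hLbdd hlr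
  have i0 := integrable_gap_rpow_neg (a := 2 + γ) (by linarith [hγ.1]) (by linarith [hγ.2]) hlr
  set I := gapIntegral (2 + γ) l
  have hI : 0 ≤ I := gapIntegral_nonneg _ hlr
  have hω : 0 < η / (2 * (I + 1)) := by positivity
  obtain ⟨δ, hδ, hδC⟩ := Metric.uniformContinuousOn_iff.1
    (isCompact_triangle.uniformContinuousOn_of_continuous hC) _ hω
  have hη' : 0 < η / (2 * (M + 1)) := by positivity
  -- Each coordinate of the sample point is within (l + 1) h of `t`.
  have hδl : 0 < δ / (l + 1) := by positivity
  filter_upwards [Ioc_mem_nhdsGT hh₀, Ioo_mem_nhdsGT hδl, hJi,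
    hJ.eventually (gt_mem_nhds hη')] with h hh hhδ hJih hJh t ht htl
  obtain ⟨hint, heq, -⟩ := hrep h hh l hl t ht htl
  have hhpos := hh.1
  have hh1 : (l + 1) * h < δ := by rw [mul_comm]; exact (lt_div_iff₀ (by positivity)).1 hhδ.2
  rw [heq, rho_eq_gapIntegral hγ l hl, gapIntegral, ← integral_mul_const,
    ← integral_sub hint (i0.mul_const _), ← Real.norm_eq_abs]
  have hlh : 2 * h ≤ l * h := mul_le_mul_of_nonneg_right hlr hhpos.le
  refine (norm_integral_le_of_norm_le ((hJih.const_mul M).add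
    (i0.const_mul (η / (2 * (I + 1))))) ?_).trans ?_
  · filter_upwards [ae_cube_mem] with p hp
    have hpos : 0 < gap l p := by linarith [sub_two_le_gap (l := (l : ℝ)) hp]
    have hmem : samplePoint l h t p ∈ triangle := by
      obtain ⟨⟨p1, p2⟩, p3, p4⟩ := hp
      refine ⟨?_, ?_, ?_⟩ <;> simp only [samplePoint]
      · nlinarith [p1.1, p2.2]
      · nlinarith [p1.2, p2.1, p3.1, p4.2]
      · nlinarith [p3.2, p4.1]
    have httm : (t, t) ∈ triangle := ⟨by linarith, le_rfl, by nlinarith⟩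
    have hdist : dist (samplePoint l h t p) (t, t) < δ := by
      obtain ⟨⟨p1, p2⟩, p3, p4⟩ := hp
      rw [Prod.dist_eq, Real.dist_eq, Real.dist_eq, max_lt_iff, abs_lt, abs_lt]
      simp only [samplePoint]
      refine ⟨⟨?_, ?_⟩, ?_, ?_⟩
      · nlinarith [p3.1, p4.2]
      · nlinarith [p3.2, p4.1]
      · nlinarith [p1.1, p2.2]
      · nlinarith [p1.2, p2.1]
    have hc := hδC _ hmem _ httm hdist
    have hCe : truncC C (samplePoint l h t p) =
        C (samplePoint l h t p).1 (samplePoint l h t p).2 := indicator_of_mem hmem _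
    rw [← hCe, Real.dist_eq] at hc
    have hMp := hM (samplePoint l h t p)
    set c := truncC C (samplePoint l h t p)
    have hq : 0 ≤ gap l p ^ (-(2 + γ)) := Real.rpow_nonneg hpos.le _
    -- The error splits into that of replacing the ratio of L by 1 and that of replacing C by its
    -- diagonal value. Each contributes at most η/2; the +1 in the denominators avoids division by
    -- zero.
    have : normKern γ L C l h t p - gap l p ^ (-(2 + γ)) * C t t =
        ((truncL L (h * gap l p) / L h - 1) * c + (c - C t t)) * gap l p ^ (-(2 + γ)) := by
      unfold normKern; ring
    rw [this, norm_mul, Real.norm_of_nonneg hq, Real.norm_eq_abs]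
    calc _ ≤ (|truncL L (h * gap l p) / L h - 1| * M + η / (2 * (I + 1))) *
          gap l p ^ (-(2 + γ)) := by
          gcongr
          refine (abs_add_le _ _).trans ?_
          rw [abs_mul]
          gcongr
      _ = _ := by simp only [Pi.add_apply]; ring
  · simp only [Pi.add_apply]
    rw [integral_add (hJih.const_mul M) (i0.const_mul _), integral_const_mul, integral_const_mul]
    calc _ ≤ M * (η / (2 * (M + 1))) + η / (2 * (I + 1)) * I := by
          gcongr
          exact le_rfl
      _ ≤ (M + 1) * (η / (2 * (M + 1))) + η / (2 * (I + 1)) * (I + 1) := by gcongr <;> linarith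
      _ = η := by field_simp; ring

/-! ### Uniform estimates and Riemann sums on the open interval. -/

lemma abs_le_of_supAbs_le {S : Set ℝ} {F : ℝ → ℝ} {ε : ℝ} (hε : 0 ≤ ε)
    (h : supAbs S F ≤ ENNReal.ofReal ε) {t : ℝ} (ht : t ∈ S) : |F t| ≤ ε := by
  have h1 : ENNReal.ofReal |F t| ≤ ENNReal.ofReal ε :=
    (le_iSup₂ (f := fun t (_ : t ∈ S) => ENNReal.ofReal |F t|) t ht).trans h
  exact (ENNReal.ofReal_le_ofReal_iff hε).1 h1

lemma eventually_abs_le_of_tendsto_supAbs {S : ℝ → Set ℝ} {F : ℝ → ℝ → ℝ}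
    (h : Tendsto (fun h => supAbs (S h) (F h)) (𝓝[>] 0) (𝓝 0)) {ε : ℝ} (hε : 0 < ε) :
    ∀ᶠ h in 𝓝[>] (0 : ℝ), ∀ t ∈ S h, |F h t| ≤ ε := by
  filter_upwards [h.eventually (ge_mem_nhds (ENNReal.ofReal_pos.2 hε))] with x hx t ht
  exact abs_le_of_supAbs_le hε.le hx ht

lemma eventually_abs_le_of_tendsto_supAbs_div_sqrt {S : ℝ → Set ℝ} {F : ℝ → ℝ → ℝ}
    (h : Tendsto (fun h => supAbs (S h) (F h) / ENNReal.ofReal (Real.sqrt h)) (𝓝[>] 0) (𝓝 0))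
    {ε : ℝ} (hε : 0 < ε) :
    ∀ᶠ h in 𝓝[>] (0 : ℝ), ∀ t ∈ S h, |F h t| ≤ ε * √h := by
  filter_upwards [h.eventually (ge_mem_nhds (ENNReal.ofReal_pos.2 hε)), self_mem_nhdsWithin]
    with x hx hx0 t ht
  refine abs_le_of_supAbs_le (by positivity) ?_ ht
  have hs : 0 < √x := Real.sqrt_pos.2 hx0
  rw [ENNReal.ofReal_mul hε.le]
  exact (ENNReal.div_le_iff (ENNReal.ofReal_pos.2 hs).ne' ENNReal.ofReal_ne_top).1 hx

lemma intervalIntegrable_of_continuousOn_Ioo {F : ℝ → ℝ} {M : ℝ}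
    (hF : ContinuousOn F (Ioo 0 1)) (hM : ∀ x ∈ Ioo (0 : ℝ) 1, |F x| ≤ M) :
    IntervalIntegrable F volume 0 1 := by
  rw [intervalIntegrable_iff_integrableOn_Ioo_of_le zero_le_one]
  exact Integrable.of_bound (hF.aestronglyMeasurable measurableSet_Ioo) M
    ((ae_restrict_mem measurableSet_Ioo).mono fun x hx => hM x hx)

lemma div_mem_Ioo {n m k : ℕ} (hk : k ∈ Finset.Ico 1 (n - m)) : (k : ℝ) / n ∈ Ioo (0 : ℝ) 1 := by
  rw [Finset.mem_Ico] at hk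
  have hk0 : (0 : ℝ) < k := by exact_mod_cast hk.1
  have hkn : (k : ℝ) < n := by exact_mod_cast (by omega : k < n)
  have hn : (0 : ℝ) < n := hk0.trans hkn
  exact ⟨by positivity, (div_lt_one hn).2 hkn⟩

/-- Convergence of Riemann sums for bounded continuous functions on the open interval. -/
lemma tendsto_riemann_sum {F : ℝ → ℝ} {M : ℝ}
    (hF : ContinuousOn F (Ioo 0 1)) (hM : ∀ x ∈ Ioo (0 : ℝ) 1, |F x| ≤ M) (m : ℕ) :
    Tendsto (fun n : ℕ => (1 / n : ℝ) * ∑ k ∈ Finset.Ico 1 (n - m), F (k / n)) atTop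
      (𝓝 (∫ x in (0 : ℝ)..1, F x)) := by
  have hM0 : 0 ≤ M := (abs_nonneg _).trans (hM (1 / 2) ⟨by norm_num, by norm_num⟩)
  -- The Riemann sum is the integral of a step function, equal to F(⌈nx⌉ / n) where that index is in
  -- range. Dominated convergence then applies, with no behaviour at the end points required.
  set f : ℕ → ℝ → ℝ := fun n x => ∑ k ∈ Finset.Ico 1 (n - m),
    (Ioc (((k - 1 : ℕ) : ℝ) / n) (k / n)).indicator (fun _ => F (k / n)) x with hf
  have hfm : ∀ n, Measurable (f n) := fun n =>
    Finset.measurable_fun_sum _ fun k _ => measurable_const.indicator measurableSet_Ioc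
  have hfeq : ∀ n x, 0 < n → f n x =
      if ⌈(n : ℝ) * x⌉₊ ∈ Finset.Ico 1 (n - m) then F (⌈(n : ℝ) * x⌉₊ / n) else 0 := by
    intro n x hn
    have hn' : (0 : ℝ) < n := by exact_mod_cast hn
    have h1 : ∀ k ∈ Finset.Ico 1 (n - m),
        (Ioc (((k - 1 : ℕ) : ℝ) / n) (k / n)).indicator (fun _ => F (k / n)) x =
        if ⌈(n : ℝ) * x⌉₊ = k then F (k / n) else 0 := by
      intro k hk
      have hk1 := (Finset.mem_Ico.1 hk).1
      rw [indicator_apply]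
      congr 1
      rw [Nat.ceil_eq_iff (by omega), mem_Ioc, div_lt_iff₀ hn', le_div_iff₀ hn', mul_comm x]
    simp only [hf]
    rw [Finset.sum_congr rfl h1, Finset.sum_ite_eq]
  have hint : ∀ᶠ n : ℕ in atTop, ∫ x in (0 : ℝ)..1, f n x =
      (1 / n : ℝ) * ∑ k ∈ Finset.Ico 1 (n - m), F (k / n) := by
    filter_upwards [eventually_gt_atTop 0] with n hn
    have hn' : (0 : ℝ) < n := by exact_mod_cast hn
    rw [intervalIntegral.integral_of_le zero_le_one]
    simp only [hf]
    rw [integral_finsetSum _ fun k _ => (integrable_const _).indicator measurableSet_Ioc,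
      Finset.mul_sum]
    refine Finset.sum_congr rfl fun k hk => ?_
    have hk1 := (Finset.mem_Ico.1 hk).1
    have hkn := (div_mem_Ioo hk).2
    have hsub : Ioc (((k - 1 : ℕ) : ℝ) / n) (k / n) ⊆ Ioc 0 1 :=
      Ioc_subset_Ioc (by positivity) hkn.le
    rw [integral_indicator measurableSet_Ioc, Measure.restrict_restrict measurableSet_Ioc,
      inter_eq_left.2 hsub, setIntegral_const, measureReal_def, Real.volume_Ioc, smul_eq_mul,
      ← sub_div, Nat.cast_sub hk1, Nat.cast_one, sub_sub_cancel,
      ENNReal.toReal_ofReal (by positivity)]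
  refine (Tendsto.congr' hint ?_)
  simp_rw [intervalIntegral.integral_of_le zero_le_one]
  refine tendsto_integral_filter_of_dominated_convergence (fun _ => M)
    (Eventually.of_forall fun n => (hfm n).aestronglyMeasurable) ?_ (integrable_const _) ?_
  · filter_upwards [eventually_gt_atTop 0] with n hn
    refine Eventually.of_forall fun x => ?_
    rw [hfeq n x hn]
    split_ifs with h
    · exact hM _ (div_mem_Ioo h)
    · simpa using hM0
  · filter_upwards [ae_unif_mem] with x hx
    have hlim : Tendsto (fun n : ℕ => (⌈(n : ℝ) * x⌉₊ : ℝ) / n) atTop (𝓝 x) := by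
      have := (tendsto_nat_ceil_mul_div_atTop hx.1.le).comp (tendsto_natCast_atTop_atTop (R := ℝ))
      refine this.congr fun n => ?_
      simp [mul_comm]
    have hFx : Tendsto (fun n : ℕ => F (⌈(n : ℝ) * x⌉₊ / n)) atTop (𝓝 (F x)) :=
      (hF.continuousAt (Ioo_mem_nhds hx.1 hx.2)).tendsto.comp hlim
    refine hFx.congr' ?_
    -- Because x < 1, the index ⌈nx⌉ eventually stays below n - m, so omitting the last terms does
    -- not matter.
    have hgap : 0 < (1 - x) / 2 := by linarith [hx.2]
    have hev : ∀ᶠ n : ℕ in atTop, ((m : ℝ) + 1) / n < (1 - x) / 2 :=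
      (tendsto_const_div_atTop_nhds_zero_nat _).eventually (gt_mem_nhds hgap)
    filter_upwards [eventually_gt_atTop 0, hev, hlim.eventually (gt_mem_nhds
      (show x < x + (1 - x) / 2 by linarith))] with n hn h1 h2
    have hn' : (0 : ℝ) < n := by exact_mod_cast hn
    rw [hfeq n x hn, if_pos]
    rw [Finset.mem_Ico]
    refine ⟨Nat.ceil_pos.2 (mul_pos hn' hx.1), ?_⟩
    have h3 : (⌈(n : ℝ) * x⌉₊ : ℝ) / n + (m + 1) / n < 1 := by linarith
    rw [← add_div, div_lt_one hn'] at h3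
    have h4 : ⌈(n : ℝ) * x⌉₊ + (m + 1) < n := by exact_mod_cast h3
    omega

lemma card_Ico_le (n m : ℕ) : ((Finset.Ico 1 (n - m)).card : ℝ) ≤ n := by
  rw [Nat.card_Ico]
  exact_mod_cast (by omega : n - m - 1 ≤ n)

/-- Riemann sums of squares of uniform approximations. -/
lemma tendsto_riemann_sum_sq {F : ℝ → ℝ} {M : ℝ}
    (hF : ContinuousOn F (Ioo 0 1)) (hM : ∀ x ∈ Ioo (0 : ℝ) 1, |F x| ≤ M) (m : ℕ)
    {a : ℕ → ℕ → ℝ}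
    (ha : ∀ ε > 0, ∀ᶠ n in atTop, ∀ k ∈ Finset.Ico 1 (n - m), |a n k - F (k / n)| ≤ ε) :
    Tendsto (fun n : ℕ => (1 / n : ℝ) * ∑ k ∈ Finset.Ico 1 (n - m), a n k ^ 2) atTop
      (𝓝 (∫ x in (0 : ℝ)..1, F x ^ 2)) := by
  have hM0 : 0 ≤ M := (abs_nonneg _).trans (hM (1 / 2) ⟨by norm_num, by norm_num⟩)
  have h1 := tendsto_riemann_sum (F := fun x => F x ^ 2) (M := M ^ 2) (hF.pow 2)
    (fun x hx => by
      rw [abs_pow]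
      exact pow_le_pow_left₀ (abs_nonneg _) (hM x hx) 2) m
  have h2 : Tendsto (fun n : ℕ => (1 / n : ℝ) * ∑ k ∈ Finset.Ico 1 (n - m),
      (a n k ^ 2 - F (k / n) ^ 2)) atTop (𝓝 0) := by
    rw [Metric.tendsto_atTop]
    intro ε hε
    set η := min 1 (ε / (2 * (1 + 2 * M)))
    have hη : 0 < η := lt_min one_pos (by positivity)
    obtain ⟨N, hN⟩ := eventually_atTop.1 ((ha η hη).and (eventually_gt_atTop 0))
    refine ⟨N, fun n hn => ?_⟩
    obtain ⟨h3, h4⟩ := hN n hn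
    have hn' : (0 : ℝ) < n := by exact_mod_cast h4
    have h5 : ∀ k ∈ Finset.Ico 1 (n - m), |a n k ^ 2 - F (k / n) ^ 2| ≤ η * (1 + 2 * M) := by
      intro k hk
      have e1 := h3 k hk
      have e2 := hM _ (div_mem_Ioo hk)
      have e3 : |a n k + F (k / n)| ≤ 1 + 2 * M := by
        calc |a n k + F (k / n)| = |(a n k - F (k / n)) + 2 * F (k / n)| := by ring_nf
          _ ≤ |a n k - F (k / n)| + |2 * F (k / n)| := abs_add_le _ _
          _ ≤ 1 + 2 * M := by
            rw [abs_mul, abs_two]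
            linarith [min_le_left 1 (ε / (2 * (1 + 2 * M)))]
      rw [sq_sub_sq, abs_mul, mul_comm]
      gcongr
    rw [dist_zero_right, Real.norm_eq_abs, abs_mul, abs_of_pos (by positivity : 0 < 1 / (n : ℝ))]
    calc _ ≤ 1 / (n : ℝ) * ∑ k ∈ Finset.Ico 1 (n - m), |a n k ^ 2 - F (k / n) ^ 2| := by
          gcongr
          exact Finset.abs_sum_le_sum_abs _ _
      _ ≤ 1 / (n : ℝ) * ∑ k ∈ Finset.Ico 1 (n - m), η * (1 + 2 * M) := by
          gcongr with k hk
          exact h5 k hk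
      _ ≤ 1 / (n : ℝ) * (n * (η * (1 + 2 * M))) := by
          rw [Finset.sum_const, nsmul_eq_mul]
          exact mul_le_mul_of_nonneg_left (mul_le_mul_of_nonneg_right (card_Ico_le n m)
            (by positivity)) (by positivity)
      _ = η * (1 + 2 * M) := by field_simp
      _ ≤ ε / (2 * (1 + 2 * M)) * (1 + 2 * M) := by gcongr; exact min_le_right _ _
      _ = ε / 2 := by field_simp
      _ < ε := by linarith
  have h3 := h2.add h1
  rw [zero_add] at h3
  refine h3.congr fun n => ?_
  rw [← mul_add, ← Finset.sum_add_distrib]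
  simp

lemma holder_bound {g : ℝ → ℝ} {K r : ℝ≥0} (hg : HolderOnWith K r g (Ioo 0 1))
    {x y δ : ℝ} (hx : x ∈ Ioo (0 : ℝ) 1) (hy : y ∈ Ioo (0 : ℝ) 1) (hxy : |x - y| ≤ δ) :
    |g x - g y| ≤ K * δ ^ (r : ℝ) := by
  lift δ to ℝ≥0 using (abs_nonneg _).trans hxy
  have h := hg.nndist_le_of_le (d := δ) hx hy (by
    rw [← NNReal.coe_le_coe, coe_nndist, Real.dist_eq]; exact hxy)
  rw [← NNReal.coe_le_coe, coe_nndist, Real.dist_eq] at h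
  simpa using h

lemma exists_bound_of_holder {g : ℝ → ℝ} {K r : ℝ≥0} (hg : HolderOnWith K r g (Ioo 0 1)) :
    ∃ M, 0 ≤ M ∧ ∀ x ∈ Ioo (0 : ℝ) 1, |g x| ≤ M := by
  refine ⟨|g (1 / 2)| + K, by positivity, fun x hx => ?_⟩
  have h := holder_bound hg hx (y := 1 / 2) (δ := 1) ⟨by norm_num, by norm_num⟩
    (by rw [abs_le]; constructor <;> linarith [hx.1, hx.2])
  rw [Real.one_rpow, mul_one] at h
  calc |g x| = |g (1 / 2) + (g x - g (1 / 2))| := by ring_nf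
    _ ≤ _ := (abs_add_le _ _).trans (by gcongr)

/-- The Riemann sums of a Hölder function of exponent larger than `1 / 2` converge faster than
`n^{-1/2}`. -/
lemma tendsto_sqrt_mul_riemann_sum_sub {g : ℝ → ℝ} {K r : ℝ≥0} (hr : 1 / 2 < r)
    (hg : HolderOnWith K r g (Ioo 0 1)) :
    Tendsto (fun n : ℕ => √n * ((1 / n : ℝ) * ∑ k ∈ Finset.Ico 1 n, g (k / n) -
      ∫ x in (0 : ℝ)..1, g x)) atTop (𝓝 0) := by
  have hr' : (1 / 2 : ℝ) < r := by exact_mod_cast hr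
  obtain ⟨M, hM0, hM⟩ := exists_bound_of_holder hg
  have hi := intervalIntegrable_of_continuousOn_Ioo
    (hg.continuousOn (lt_of_le_of_lt (by positivity) hr)) hM
  -- The first cell [0, 1/n] carries no sample and costs M/n. Each other cell costs K n^{-r} · 1/n
  -- by the Hölder bound, and there are at most n of them. Both totals survive multiplication by √n
  -- because r > 1/2.
  have hbound : ∀ᶠ n : ℕ in atTop, ‖√n * ((1 / n : ℝ) * ∑ k ∈ Finset.Ico 1 n, g (k / n) -
      ∫ x in (0 : ℝ)..1, g x)‖ ≤ M * (n : ℝ) ^ (-(1 / 2) : ℝ) + K * (n : ℝ) ^ (-(r - 1 / 2) : ℝ) := by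
    filter_upwards [eventually_gt_atTop 0] with n hn
    have hn' : (0 : ℝ) < n := by exact_mod_cast hn
    have hsubi : ∀ a b : ℝ, 0 ≤ a → a ≤ b → b ≤ 1 → IntervalIntegrable g volume a b := by
      intro a b ha hab hb
      refine hi.mono_set ?_
      rw [uIcc_of_le hab, uIcc_of_le zero_le_one]
      exact Icc_subset_Icc ha hb
    have hk1 : ∀ k < n, ((k + 1 : ℕ) : ℝ) / n ≤ 1 := fun k hk =>
      (div_le_one hn').2 (by exact_mod_cast hk)
    have hkk : ∀ k : ℕ, (k : ℝ) / n ≤ ((k + 1 : ℕ) : ℝ) / n := fun k => by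
      gcongr; simp
    have hsum := intervalIntegral.sum_integral_adjacent_intervals_Ico (f := g) (μ := volume)
      (a := fun k : ℕ => (k : ℝ) / n) (m := 1) (n := n) hn
      (fun k hk => hsubi _ _ (by positivity) (hkk k) (hk1 k hk.2))
    have hsplit := intervalIntegral.integral_add_adjacent_intervals
      (hsubi 0 ((1 : ℕ) / n) le_rfl (by positivity) (by simpa using hk1 0 hn))
      (hsubi ((1 : ℕ) / n) 1 (by positivity) (by simpa using hk1 0 hn) le_rfl)
    rw [div_self hn'.ne'] at hsum
    rw [← hsum] at hsplit
    have e0 : |∫ x in (0 : ℝ)..((1 : ℕ) / n), g x| ≤ M / n := by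
      have := intervalIntegral.norm_integral_le_of_norm_le_const_ae (f := g) (C := M) (a := 0)
        (b := (1 : ℕ) / n) ?_
      · rw [Real.norm_eq_abs] at this
        simpa [abs_of_pos hn', div_eq_mul_inv] using this
      -- The function is controlled only on the open interval, so the possible end point 1 is
      -- discarded as a null set.
      · have hne : ∀ᵐ x ∂(volume : Measure ℝ), x ≠ 1 := by simp [ae_iff]
        filter_upwards [hne] with x hx hxm
        rw [uIoc_of_le (by positivity)] at hxm
        exact hM x ⟨hxm.1, lt_of_le_of_ne (hxm.2.trans (by simpa using hk1 0 hn)) hx⟩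
    have ek : ∀ k ∈ Finset.Ico 1 n,
        |1 / (n : ℝ) * g (k / n) - ∫ x in ((k : ℝ) / n)..(((k + 1 : ℕ) : ℝ) / n), g x| ≤
          K * (1 / (n : ℝ)) ^ (r : ℝ) * (1 / n) := by
      intro k hk
      have hk' := Finset.mem_Ico.1 hk
      have hlen : ((k + 1 : ℕ) : ℝ) / n - k / n = 1 / n := by
        push_cast; ring
      have hconst : 1 / (n : ℝ) * g (k / n) =
          ∫ _ in ((k : ℝ) / n)..(((k + 1 : ℕ) : ℝ) / n), g (k / n) := by
        rw [intervalIntegral.integral_const, hlen, smul_eq_mul]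
      rw [hconst, ← intervalIntegral.integral_sub intervalIntegrable_const
        (hsubi _ _ (by positivity) (hkk k) (hk1 k hk'.2))]
      have := intervalIntegral.norm_integral_le_of_norm_le_const_ae
        (f := fun x => g (k / n) - g x) (C := K * (1 / (n : ℝ)) ^ (r : ℝ)) (a := (k : ℝ) / n)
        (b := ((k + 1 : ℕ) : ℝ) / n) ?_
      · rw [hlen, abs_of_pos (by positivity : 0 < 1 / (n : ℝ))] at this
        exact this
      · have hne : ∀ᵐ x ∂(volume : Measure ℝ), x ≠ 1 := by simp [ae_iff]
        filter_upwards [hne] with x hx hxm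
        rw [uIoc_of_le (hkk k)] at hxm
        have hkpos := div_mem_Ioo (m := 0) (k := k) (n := n) (by simpa using hk)
        refine holder_bound hg hkpos
          ⟨hkpos.1.trans hxm.1, lt_of_le_of_ne (hxm.2.trans (hk1 k hk'.2)) hx⟩ ?_
        rw [abs_sub_comm, abs_of_nonneg (by linarith [hxm.1])]
        linarith [hxm.2]
    have key : |(1 / n : ℝ) * ∑ k ∈ Finset.Ico 1 n, g (k / n) - ∫ x in (0 : ℝ)..1, g x| ≤
        M / n + K * (1 / (n : ℝ)) ^ (r : ℝ) := by
      rw [← hsplit, Finset.mul_sum]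
      rw [sub_add_eq_sub_sub, sub_right_comm, ← Finset.sum_sub_distrib]
      refine (abs_sub _ _).trans ?_
      rw [add_comm]
      refine add_le_add e0 ((Finset.abs_sum_le_sum_abs _ _).trans ((Finset.sum_le_sum ek).trans ?_))
      rw [Finset.sum_const, nsmul_eq_mul]
      calc _ ≤ (n : ℝ) * (K * (1 / (n : ℝ)) ^ (r : ℝ) * (1 / n)) :=
            mul_le_mul_of_nonneg_right (card_Ico_le n 0) (by positivity)
        _ = _ := by field_simp
    rw [norm_mul, Real.norm_of_nonneg (Real.sqrt_nonneg _), Real.norm_eq_abs]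
    refine (mul_le_mul_of_nonneg_left key (Real.sqrt_nonneg _)).trans (le_of_eq ?_)
    have p1 : √(n : ℝ) * (M / n) = M * (n : ℝ) ^ (-(1 / 2) : ℝ) := by
      rw [Real.sqrt_eq_rpow, mul_div_assoc', mul_comm _ M, mul_div_assoc]
      nth_rewrite 2 [← Real.rpow_one (n : ℝ)]
      rw [← Real.rpow_sub hn']
      norm_num
    have p2 : √(n : ℝ) * (K * (1 / (n : ℝ)) ^ (r : ℝ)) = K * (n : ℝ) ^ (-(r - 1 / 2) : ℝ) := by
      rw [Real.sqrt_eq_rpow, one_div (n : ℝ), Real.inv_rpow hn'.le, ← Real.rpow_neg hn'.le,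
        mul_left_comm, ← Real.rpow_add hn']
      ring_nf
    rw [mul_add, p1, p2]
  refine squeeze_zero_norm' hbound ?_
  have t1 : Tendsto (fun n : ℕ => (n : ℝ) ^ (-(1 / 2) : ℝ)) atTop (𝓝 0) :=
    (tendsto_rpow_neg_atTop (by norm_num)).comp tendsto_natCast_atTop_atTop
  have t2 : Tendsto (fun n : ℕ => (n : ℝ) ^ (-(r - 1 / 2) : ℝ)) atTop (𝓝 0) :=
    (tendsto_rpow_neg_atTop (by linarith)).comp tendsto_natCast_atTop_atTop
  simpa using (t1.const_mul M).add (t2.const_mul (K : ℝ))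

/-! ### Matrices dominated along their diagonals. -/

/-- A symmetric double sum, split along the diagonals. -/
lemma sum_sum_Ico_eq_sum_diagonals (F : ℕ → ℕ → ℝ) (hF : ∀ j k, F j k = F k j) (n : ℕ) :
    ∑ j ∈ Finset.Ico 1 n, ∑ k ∈ Finset.Ico 1 n, F j k =
      ∑ k ∈ Finset.Ico 1 n, F k k +
        2 * ∑ l ∈ Finset.Ico 1 n, ∑ k ∈ Finset.Ico 1 (n - l), F (k + l) k := by
  induction n with
  | zero => simp
  | succ n ih =>
    rcases Nat.eq_zero_or_pos n with rfl | hn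
    · simp
    have h1 : ∑ j ∈ Finset.Ico 1 n, F j n = ∑ k ∈ Finset.Ico 1 n, F n k :=
      Finset.sum_congr rfl fun j _ => hF j n
    have h2 : ∑ l ∈ Finset.Ico 1 n, ∑ k ∈ Finset.Ico 1 (n + 1 - l), F (k + l) k =
        ∑ l ∈ Finset.Ico 1 n, (∑ k ∈ Finset.Ico 1 (n - l), F (k + l) k + F n (n - l)) := by
      refine Finset.sum_congr rfl fun l hl => ?_
      rw [Finset.mem_Ico] at hl
      rw [show n + 1 - l = n - l + 1 by omega, Finset.sum_Ico_succ_top (by omega),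
        show n - l + l = n by omega]
    have h3 : ∑ l ∈ Finset.Ico 1 n, F n (n - l) = ∑ k ∈ Finset.Ico 1 n, F n k := by
      rw [Finset.sum_Ico_reflect (fun k => F n k) 1 (by omega : n ≤ n + 1)]
      simp
    rw [Finset.sum_Ico_succ_top hn, Finset.sum_Ico_succ_top hn, Finset.sum_Ico_succ_top hn,
      Finset.sum_Ico_succ_top hn]
    simp_rw [Finset.sum_Ico_succ_top hn]
    rw [Finset.sum_add_distrib, h1, h2, Finset.sum_add_distrib, h3, ih]
    simp
    ring

/-- With truncated subtraction, j - k + (k - j) is |j - k|. On each side of `j` this distance is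
injective in `k`, so a row meets each lag at most twice. -/
lemma sum_le_two_mul_tsum {b : ℕ → ℝ} (hb : Summable b) (hb0 : ∀ l, 0 ≤ b l) (s : Finset ℕ)
    (j : ℕ) : ∑ k ∈ s, b (j - k + (k - j)) ≤ 2 * ∑' l, b l := by
  have h1 : ∀ t : Finset ℕ, (∀ f : ℕ → ℕ, Set.InjOn f t → ∑ k ∈ t, b (f k) ≤ ∑' l, b l) := by
    intro t f hf
    rw [← Finset.sum_image (f := b) hf]
    exact hb.sum_le_tsum _ fun _ _ => hb0 _
  rw [← Finset.sum_filter_add_sum_filter_not s (fun k => k ≤ j), two_mul]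
  refine add_le_add (h1 _ _ ?_) (h1 _ _ ?_)
  · intro x hx y hy hxy
    simp only [Finset.coe_filter, mem_ofPred_eq] at hx hy hxy
    omega
  · intro x hx y hy hxy
    simp only [Finset.coe_filter, mem_ofPred_eq] at hx hy hxy
    omega

lemma summable_sq_of_summable {b : ℕ → ℝ} (hb : Summable b) (hb0 : ∀ l, 0 ≤ b l) :
    Summable fun l => b l ^ 2 := by
  refine hb.of_norm_bounded_eventually_nat ?_
  filter_upwards [hb.tendsto_atTop_zero.eventually (gt_mem_nhds one_pos)] with l hl
  rw [Real.norm_of_nonneg (sq_nonneg _)]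
  nlinarith [hb0 l]

/-- Limit of the normalised Hilbert-Schmidt norm of a sequence of dominated symmetric matrices,
in terms of the limits along the diagonals. -/
lemma tendsto_double_sum_of_diagonals {a : ℕ → ℕ → ℕ → ℝ} {b T : ℕ → ℝ}
    (hsymm : ∀ n j k, a n j k = a n k j) (hb : Summable b) (hb0 : ∀ l, 0 ≤ b l)
    (hab : ∀ᶠ n in atTop, ∀ l, ∀ k ∈ Finset.Ico 1 (n - l), |a n (k + l) k| ≤ b l)
    (hT : ∀ l, Tendsto (fun n : ℕ => (1 / n : ℝ) * ∑ k ∈ Finset.Ico 1 (n - l), a n (k + l) k ^ 2)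
      atTop (𝓝 (T l))) :
    Tendsto (fun n : ℕ => (1 / n : ℝ) *
      ∑ j ∈ Finset.Ico 1 n, ∑ k ∈ Finset.Ico 1 n, a n j k ^ 2)
      atTop (𝓝 (T 0 + 2 * ∑' l, T (l + 1))) := by
  -- Limit and sum over lags are exchanged: diagonal l + 1 has at most n entries, so its normalised
  -- sum of squares is at most b(l + 1)². Diagonals of lag at least n are empty, so the series is
  -- the finite sum.
  have hlim := tendsto_tsum_of_dominated_convergence (𝓕 := atTop)
    (f := fun (n : ℕ) (l : ℕ) => (1 / n : ℝ) *
      ∑ k ∈ Finset.Ico 1 (n - (l + 1)), a n (k + (l + 1)) k ^ 2)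
    (g := fun l => T (l + 1)) (bound := fun l => b (l + 1) ^ 2)
    ((summable_nat_add_iff 1).2 (summable_sq_of_summable hb hb0)) (fun l => hT (l + 1)) (by
      filter_upwards [hab, eventually_gt_atTop 0] with n hn hn0 l
      have hn' : (0 : ℝ) < n := by exact_mod_cast hn0
      rw [Real.norm_of_nonneg (by positivity)]
      calc _ ≤ (1 / n : ℝ) * ∑ k ∈ Finset.Ico 1 (n - (l + 1)), b (l + 1) ^ 2 := by
            refine mul_le_mul_of_nonneg_left (Finset.sum_le_sum fun k hk => ?_) (by positivity)
            exact sq_le_sq' (by linarith [neg_abs_le (a n (k + (l + 1)) k), hn (l + 1) k hk])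
              ((le_abs_self _).trans (hn (l + 1) k hk))
        _ ≤ (1 / n : ℝ) * (n * b (l + 1) ^ 2) := by
            rw [Finset.sum_const, nsmul_eq_mul]
            exact mul_le_mul_of_nonneg_left (mul_le_mul_of_nonneg_right (card_Ico_le n _)
              (by positivity)) (by positivity)
        _ = _ := by field_simp)
  have h0 := (hT 0).add (hlim.const_mul 2)
  refine h0.congr fun n => ?_
  rw [sum_sum_Ico_eq_sum_diagonals _ (fun j k => by rw [hsymm n j k]) n]
  have h1 : ∑' l : ℕ, (1 / n : ℝ) * ∑ k ∈ Finset.Ico 1 (n - (l + 1)), a n (k + (l + 1)) k ^ 2 =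
      (1 / n : ℝ) * ∑ l ∈ Finset.Ico 1 n, ∑ k ∈ Finset.Ico 1 (n - l), a n (k + l) k ^ 2 := by
    rw [tsum_eq_sum (s := Finset.range (n - 1)), Finset.mul_sum, Finset.sum_Ico_eq_sum_range]
    · exact Finset.sum_congr rfl fun l _ => by rw [add_comm l 1]
    · intro l hl
      rw [Finset.mem_range] at hl
      rw [Finset.Ico_eq_empty (by omega)]
      simp
  rw [h1]
  simp only [Nat.sub_zero, add_zero]
  ring

/-! ### Continuity of the lag-one limit. -/

/-- The limit of the normalised first off-diagonal increments is continuous. -/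
lemma continuousOn_of_tendsto_supAbs {γ : ℝ} {L : ℝ → ℝ} {R : ℝ → ℝ → ℝ} {gt : ℝ → ℝ}
    (hR : ContinuousOn (fun p : ℝ × ℝ => R p.1 p.2) (Icc 0 1 ×ˢ Icc 0 1))
    (hoff : Tendsto
      (fun h : ℝ => supAbs (Icc h (1 - 2 * h)) (fun t =>
          delta1 h (delta2 h R) (t + h) t / (h ^ (2 - γ) * L h) - gt t))
      (𝓝[>] 0) (𝓝 0)) : ContinuousOn gt (Ioo 0 1) := by
  intro t₀ ht₀
  refine ContinuousAt.continuousWithinAt ?_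
  -- Near an interior point, `gt` is a uniform limit of normalised differences, each continuous
  -- because R is.
  refine continuousAt_of_locally_uniform_approx_of_continuousAt fun u hu => ?_
  obtain ⟨ε, hε, hεu⟩ := Metric.mem_uniformity_dist.1 hu
  have hd1 : 0 < t₀ / 2 := by linarith [ht₀.1]
  have hd2 : 0 < (1 - t₀) / 4 := by linarith [ht₀.2]
  have hsmall : ∀ᶠ h in 𝓝[>] (0 : ℝ), h ∈ Ioo 0 (min (t₀ / 2) ((1 - t₀) / 4)) :=
    Ioo_mem_nhdsGT (lt_min hd1 hd2)
  obtain ⟨h, hh1, hh2, hh3⟩ :=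
    ((eventually_abs_le_of_tendsto_supAbs hoff (half_pos hε)).and hsmall).exists
  have hm1 := hh3.trans_le (min_le_left _ _)
  have hm2 := hh3.trans_le (min_le_right _ _)
  refine ⟨Icc h (1 - 2 * h), Icc_mem_nhds (by linarith) (by linarith),
    fun t => delta1 h (delta2 h R) (t + h) t / (h ^ (2 - γ) * L h), ?_, fun t ht => ?_⟩
  · have hc : ∀ a b : ℝ, 0 < t₀ + a → t₀ + a < 1 → 0 < t₀ + b → t₀ + b < 1 →
        ContinuousAt (fun t => R (t + a) (t + b)) t₀ := by
      intro a b ha1 ha2 hb1 hb2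
      have hRa : ContinuousAt (fun p : ℝ × ℝ => R p.1 p.2) (t₀ + a, t₀ + b) :=
        hR.continuousAt (prod_mem_nhds (Icc_mem_nhds ha1 ha2) (Icc_mem_nhds hb1 hb2))
      exact hRa.comp (f := fun t : ℝ => (t + a, t + b)) (by fun_prop)
    have e : (fun t => delta1 h (delta2 h R) (t + h) t / (h ^ (2 - γ) * L h)) = fun t =>
        ((R (t + (h + h)) (t + h) + R (t + (h + h)) (t + -h) - 2 * R (t + (h + h)) (t + 0))
        + (R (t + 0) (t + h) + R (t + 0) (t + -h) - 2 * R (t + 0) (t + 0))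
        - 2 * (R (t + h) (t + h) + R (t + h) (t + -h) - 2 * R (t + h) (t + 0))) /
          (h ^ (2 - γ) * L h) := by
      funext t
      simp only [delta1, delta2]
      rw [add_sub_cancel_right, add_assoc t h h, add_zero, sub_eq_add_neg t h]
    rw [e]
    have ct : ∀ a b : ℝ, (a = 0 ∨ a = h ∨ a = h + h ∨ a = -h) → (b = 0 ∨ b = h ∨ b = -h) →
        ContinuousAt (fun t => R (t + a) (t + b)) t₀ := by
      intro a b ha hb
      refine hc a b ?_ ?_ ?_ ?_ <;> rcases ha with rfl | rfl | rfl | rfl <;>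
        rcases hb with rfl | rfl | rfl <;> linarith [ht₀.1, ht₀.2]
    refine ContinuousAt.div_const ?_ _
    refine ((((ct _ _ ?_ ?_).add (ct _ _ ?_ ?_)).sub ((ct _ _ ?_ ?_).const_mul 2)).add
      (((ct _ _ ?_ ?_).add (ct _ _ ?_ ?_)).sub ((ct _ _ ?_ ?_).const_mul 2))).sub
      ((((ct _ _ ?_ ?_).add (ct _ _ ?_ ?_)).sub ((ct _ _ ?_ ?_).const_mul 2)).const_mul 2) <;> simp
  · refine hεu ?_
    rw [dist_comm, Real.dist_eq]
    linarith [hh1 t ht]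

/-! ### Second-order increments of the process and their covariances. -/

section

variable {Ω : Type*} {X : ℝ → Ω → ℝ}

/-- The second order increment of `X` at `k / n` with step `1 / n`. -/
noncomputable def incr (X : ℝ → Ω → ℝ) (n k : ℕ) (ω : Ω) : ℝ :=
  X (((k : ℝ) + 1) / n) ω + X (((k : ℝ) - 1) / n) ω - 2 * X ((k : ℝ) / n) ω

lemma V_eq_sum_incr (n : ℕ) (ω : Ω) :
    V X n ω = ∑ i : ↥(Finset.Ico 1 n), incr X n i ω ^ 2 :=
  (Finset.sum_coe_sort (Finset.Ico 1 n) fun k => incr X n k ω ^ 2).symm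

lemma natCast_div_mem_Icc {n m : ℕ} (hm : m ≤ n) : (m : ℝ) / n ∈ Icc (0 : ℝ) 1 :=
  ⟨by positivity, div_le_one_of_le₀ (by exact_mod_cast hm) (by positivity)⟩

lemma incr_eq {n k : ℕ} (hk : 1 ≤ k) (ω : Ω) : incr X n k ω =
    X (((k + 1 : ℕ) : ℝ) / n) ω + X (((k - 1 : ℕ) : ℝ) / n) ω - 2 * X ((k : ℝ) / n) ω := by
  unfold incr
  rw [Nat.cast_sub hk]
  push_cast
  rfl

variable [MeasurableSpace Ω] {P : Measure Ω}

lemma hasGaussianLaw_incr (hGauss : IsGaussianProcess (fun t : Icc (0 : ℝ) 1 => X t) P) (n : ℕ) :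
    HasGaussianLaw (fun ω (i : ↥(Finset.Ico 1 n)) => incr X n i ω) P := by
  -- The projection onto [0, 1] only supplies grid points of the right type for every natural index;
  -- for m ≤ n it changes nothing. The increments are then a linear image of the Gaussian vector of
  -- grid values.
  set pt : ℕ → Icc (0 : ℝ) 1 := fun m => projIcc 0 1 zero_le_one ((m : ℝ) / n) with hpt
  have hptX : ∀ m ≤ n, ∀ ω, X (pt m) ω = X ((m : ℝ) / n) ω := by
    intro m hm ω
    simp only [hpt]
    rw [projIcc_of_mem zero_le_one (natCast_div_mem_Icc hm)]
  have h1 := (hGauss.comp_right pt).hasGaussianLaw (Finset.range (n + 1))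
  have h2 := h1.map_fun (ContinuousLinearMap.pi fun i : ↥(Finset.Ico 1 n) =>
    (ContinuousLinearMap.proj ⟨(i : ℕ) + 1, by
      have := Finset.mem_Ico.1 i.2; exact Finset.mem_range.2 (by omega)⟩ :
        (↥(Finset.range (n + 1)) → ℝ) →L[ℝ] ℝ) +
    (ContinuousLinearMap.proj ⟨(i : ℕ) - 1, by
      have := Finset.mem_Ico.1 i.2; exact Finset.mem_range.2 (by omega)⟩ :
        (↥(Finset.range (n + 1)) → ℝ) →L[ℝ] ℝ) -
    (2 : ℝ) • (ContinuousLinearMap.proj ⟨(i : ℕ), by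
      have := Finset.mem_Ico.1 i.2; exact Finset.mem_range.2 (by omega)⟩ :
        (↥(Finset.range (n + 1)) → ℝ) →L[ℝ] ℝ))
  convert! h2 using 1
  funext ω i
  have hi := Finset.mem_Ico.1 i.2
  rw [incr_eq hi.1]
  change _ = X (pt (i + 1)) ω + X (pt (i - 1)) ω - 2 * X (pt i) ω
  rw [hptX _ (by omega), hptX _ (by omega), hptX _ (by omega)]

lemma memLp_two_of_gaussian (hGauss : IsGaussianProcess (fun t : Icc (0 : ℝ) 1 => X t) P)
    {t : ℝ} (ht : t ∈ Icc (0 : ℝ) 1) : MemLp (X t) 2 P :=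
  (hGauss.hasGaussianLaw_eval ⟨t, ht⟩).memLp_two

lemma integral_incr [IsProbabilityMeasure P]
    (hGauss : IsGaussianProcess (fun t : Icc (0 : ℝ) 1 => X t) P)
    (hCent : ∀ t ∈ Icc (0 : ℝ) 1, ∫ ω, X t ω ∂P = 0) {n k : ℕ} (hk : k ∈ Finset.Ico 1 n) :
    ∫ ω, incr X n k ω ∂P = 0 := by
  have hk' := Finset.mem_Ico.1 hk
  have m1 := natCast_div_mem_Icc (by omega : k + 1 ≤ n)
  have m2 := natCast_div_mem_Icc (by omega : k - 1 ≤ n)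
  have m3 := natCast_div_mem_Icc (by omega : k ≤ n)
  have hi : ∀ t ∈ Icc (0 : ℝ) 1, Integrable (fun ω => X t ω) P := fun t ht =>
    (memLp_two_of_gaussian hGauss ht).integrable one_le_two
  simp_rw [incr_eq hk'.1]
  rw [integral_sub (f := fun ω => X (((k + 1 : ℕ) : ℝ) / n) ω + X (((k - 1 : ℕ) : ℝ) / n) ω)
    ((hi _ m1).add (hi _ m2)) ((hi _ m3).const_mul 2),
    integral_add (hi _ m1) (hi _ m2), integral_const_mul, hCent _ m1, hCent _ m2, hCent _ m3]
  simp

lemma covariance_incr [IsProbabilityMeasure P]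
    (hGauss : IsGaussianProcess (fun t : Icc (0 : ℝ) 1 => X t) P) {n j k : ℕ}
    (hj : j ∈ Finset.Ico 1 n) (hk : k ∈ Finset.Ico 1 n) :
    cov[incr X n j, incr X n k; P] =
      delta1 (1 / n) (delta2 (1 / n) (covFun P X)) ((j : ℝ) / n) ((k : ℝ) / n) := by
  have key : ∀ A₁ A₂ A₃ B : Ω → ℝ, MemLp A₁ 2 P → MemLp A₂ 2 P → MemLp A₃ 2 P → MemLp B 2 P →
      cov[fun ω => A₁ ω + A₂ ω - 2 * A₃ ω, B; P] =
        cov[A₁, B; P] + cov[A₂, B; P] - 2 * cov[A₃, B; P] := by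
    intro A₁ A₂ A₃ B h1 h2 h3 hB
    have e : (fun ω => A₁ ω + A₂ ω - 2 * A₃ ω) = A₁ + A₂ - fun ω => 2 * A₃ ω := rfl
    rw [e, covariance_sub_left (h1.add h2) (h3.const_mul 2) hB, covariance_add_left h1 h2 hB,
      covariance_const_mul_left]
  have hmem : ∀ k ∈ Finset.Ico 1 n, MemLp (X (((k : ℝ) + 1) / n)) 2 P ∧
      MemLp (X (((k : ℝ) - 1) / n)) 2 P ∧ MemLp (X ((k : ℝ) / n)) 2 P := by
    intro k hk
    have hk' := Finset.mem_Ico.1 hk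
    have m1 := natCast_div_mem_Icc (by omega : k + 1 ≤ n)
    have m2 := natCast_div_mem_Icc (by omega : k - 1 ≤ n)
    have m3 := natCast_div_mem_Icc (by omega : k ≤ n)
    rw [Nat.cast_sub hk'.1] at m2
    push_cast at m1 m2
    exact ⟨memLp_two_of_gaussian hGauss m1, memLp_two_of_gaussian hGauss m2,
      memLp_two_of_gaussian hGauss m3⟩
  obtain ⟨j1, j2, j3⟩ := hmem j hj
  obtain ⟨k1, k2, k3⟩ := hmem k hk
  have hB : MemLp (incr X n k) 2 P := (k1.add k2).sub (k3.const_mul 2)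
  have e1 := key _ _ _ _ j1 j2 j3 hB
  have e2 : ∀ A : Ω → ℝ, MemLp A 2 P → cov[A, incr X n k; P] =
      cov[A, X (((k : ℝ) + 1) / n); P] + cov[A, X (((k : ℝ) - 1) / n); P] -
        2 * cov[A, X ((k : ℝ) / n); P] := by
    intro A hA
    rw [covariance_comm, covariance_comm A, covariance_comm A, covariance_comm A]
    exact key _ _ _ _ k1 k2 k3 hA
  rw [e2 _ j1, e2 _ j2, e2 _ j3] at e1
  refine e1.trans ?_
  simp only [delta1, delta2, covFun, ← add_div, ← sub_div]

end

/-! ### The bias and the limits along the diagonals. -/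

lemma delta_symm {R : ℝ → ℝ → ℝ} (hR : ∀ s t, R s t = R t s) (h s t : ℝ) :
    delta1 h (delta2 h R) s t = delta1 h (delta2 h R) t s := by
  simp only [delta1, delta2]
  rw [hR (s + h) (t + h), hR (s + h) (t - h), hR (s + h) t, hR (s - h) (t + h),
    hR (s - h) (t - h), hR (s - h) t, hR s (t + h), hR s (t - h), hR s t]
  ring

lemma tendsto_one_div_nhdsGT : Tendsto (fun n : ℕ => (1 / n : ℝ)) atTop (𝓝[>] 0) := by
  refine tendsto_nhdsWithin_iff.2 ⟨tendsto_one_div_atTop_nhds_zero_nat, ?_⟩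
  filter_upwards [eventually_gt_atTop 0] with n hn
  have : (0 : ℝ) < n := by exact_mod_cast hn
  exact mem_Ioi.2 (by positivity)

lemma grid_bounds {n l k : ℕ} (hk : k ∈ Finset.Ico 1 (n - l)) :
    (1 / n : ℝ) ≤ k / n ∧ (k : ℝ) / n + (l + 1) * (1 / n) ≤ 1 := by
  rw [Finset.mem_Ico] at hk
  have hn : (0 : ℝ) < n := by exact_mod_cast (by omega : 0 < n)
  have h1 : (1 : ℝ) ≤ k := by exact_mod_cast hk.1
  have h2 : (k : ℝ) + l + 1 ≤ n := by exact_mod_cast (by omega : k + l + 1 ≤ n)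
  refine ⟨by gcongr, ?_⟩
  rw [mul_one_div, ← add_div, div_le_one hn]
  linarith

lemma natCast_add_div (n l k : ℕ) : ((k + l : ℕ) : ℝ) / n = k / n + l * (1 / n) := by
  push_cast; ring

lemma holder_exponents {q : ℕ} {g : ℕ → ℝ → ℝ}
    (hgLip : ∀ i < q, ∃ K : ℝ≥0, LipschitzOnWith K (g i) (Ioo 0 1))
    (hgHol : ∃ α : ℝ≥0, 0 < α ∧ α ≤ 1 / 2 ∧ ∃ K : ℝ≥0, HolderOnWith K (1 / 2 + α) (g q) (Ioo 0 1)) :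
    ∀ i ≤ q, ∃ K r : ℝ≥0, 1 / 2 < r ∧ HolderOnWith K r (g i) (Ioo 0 1) := by
  intro i hi
  rcases hi.lt_or_eq with h | rfl
  · obtain ⟨K, hK⟩ := hgLip i h
    exact ⟨K, 1, NNReal.half_lt_self one_ne_zero, holderOnWith_one.2 hK⟩
  · obtain ⟨α, hα, -, K, hK⟩ := hgHol
    exact ⟨K, 1 / 2 + α, lt_add_of_pos_right _ hα, hK⟩

lemma tendsto_rpow_one_div {q : ℕ} {ν : ℕ → ℝ} {φ : ℝ → ℝ}
    (hνpos : ∀ i, 1 ≤ i → i ≤ q → 0 < ν i)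
    (hφlim : q ≠ 0 → Tendsto φ (𝓝[>] 0) (𝓝 0)) {i : ℕ} (hi : i ∈ Finset.Icc 1 q) :
    Tendsto (fun n : ℕ => φ (1 / n) ^ ν i) atTop (𝓝 0) := by
  rw [Finset.mem_Icc] at hi
  have hν := hνpos i hi.1 hi.2
  have h := ((hφlim (by omega)).comp tendsto_one_div_nhdsGT).rpow_const (p := ν i) (Or.inr hν.le)
  rwa [Real.zero_rpow hν.ne'] at h

/-- The bias term. -/
lemma tendsto_bias {q : ℕ} {g : ℕ → ℝ → ℝ} {ν : ℕ → ℝ} {φ : ℝ → ℝ} {a : ℕ → ℕ → ℝ}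
    (hg : ∀ i ≤ q, ∃ K r : ℝ≥0, 1 / 2 < r ∧ HolderOnWith K r (g i) (Ioo 0 1))
    (hφ : ∀ i ∈ Finset.Icc 1 q, Tendsto (fun n : ℕ => φ (1 / n) ^ ν i) atTop (𝓝 0))
    (ha : ∀ ε > 0, ∀ᶠ n : ℕ in atTop, ∀ k ∈ Finset.Ico 1 n,
      |a n k - g 0 (k / n) - ∑ i ∈ Finset.Icc 1 q, g i (k / n) * φ (1 / n) ^ ν i| ≤
        ε * √(1 / n)) :
    Tendsto (fun n : ℕ => √n * ((1 / n : ℝ) * ∑ k ∈ Finset.Ico 1 n, a n k -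
      (∫ x in (0 : ℝ)..1, g 0 x) -
      ∑ i ∈ Finset.Icc 1 q, (∫ x in (0 : ℝ)..1, g i x) * φ (1 / n) ^ ν i)) atTop (𝓝 0) := by
  have hRS : ∀ i ≤ q, Tendsto (fun n : ℕ => √n * ((1 / n : ℝ) * ∑ k ∈ Finset.Ico 1 n, g i (k / n) -
      ∫ x in (0 : ℝ)..1, g i x)) atTop (𝓝 0) := by
    intro i hi
    obtain ⟨K, r, hr, hK⟩ := hg i hi
    exact tendsto_sqrt_mul_riemann_sum_sub hr hK
  have h1 : Tendsto (fun n : ℕ => √n * ((1 / n : ℝ) * ∑ k ∈ Finset.Ico 1 n,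
      (a n k - g 0 (k / n) - ∑ i ∈ Finset.Icc 1 q, g i (k / n) * φ (1 / n) ^ ν i)))
      atTop (𝓝 0) := by
    rw [Metric.tendsto_atTop]
    intro ε hε
    obtain ⟨N, hN⟩ := eventually_atTop.1 ((ha _ (half_pos hε)).and (eventually_gt_atTop 0))
    refine ⟨N, fun n hn => ?_⟩
    obtain ⟨h2, h3⟩ := hN n hn
    have hn' : (0 : ℝ) < n := by exact_mod_cast h3
    rw [dist_zero_right, norm_mul, norm_mul, Real.norm_of_nonneg (Real.sqrt_nonneg _),
      Real.norm_of_nonneg (by positivity : 0 ≤ 1 / (n : ℝ))]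
    calc _ ≤ √n * (1 / (n : ℝ) * ∑ k ∈ Finset.Ico 1 n, ε / 2 * √(1 / n)) := by
          refine mul_le_mul_of_nonneg_left (mul_le_mul_of_nonneg_left ?_ (by positivity))
            (by positivity)
          exact (norm_sum_le _ _).trans (Finset.sum_le_sum h2)
      _ ≤ √n * (1 / (n : ℝ) * (n * (ε / 2 * √(1 / n)))) := by
          rw [Finset.sum_const, nsmul_eq_mul]
          exact mul_le_mul_of_nonneg_left (mul_le_mul_of_nonneg_left
            (mul_le_mul_of_nonneg_right (card_Ico_le n 0) (by positivity)) (by positivity))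
            (by positivity)
      _ = √n * √(1 / n) * (ε / 2) := by field_simp
      _ = ε / 2 := by
          rw [← Real.sqrt_mul hn'.le, mul_one_div_cancel hn'.ne', Real.sqrt_one, one_mul]
      _ < ε := half_lt_self hε
  -- Each Riemann error of `g i` with i ≥ 1 is already o(n^{-1/2}) and is further multiplied by a
  -- power of `φ` that tends to 0.
  have h2 : Tendsto (fun n : ℕ => ∑ i ∈ Finset.Icc 1 q, φ (1 / n) ^ ν i *
      (√n * ((1 / n : ℝ) * ∑ k ∈ Finset.Ico 1 n, g i (k / n) - ∫ x in (0 : ℝ)..1, g i x)))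
      atTop (𝓝 0) := by
    have := tendsto_finsetSum (Finset.Icc 1 q) fun i hi =>
      (hφ i hi).mul (hRS i (Finset.mem_Icc.1 hi).2)
    simpa using this
  have h3 := (h1.add (hRS 0 (Nat.zero_le q))).add h2
  simp only [add_zero] at h3
  refine h3.congr fun n => ?_
  have e1 : ∑ i ∈ Finset.Icc 1 q, φ (1 / n) ^ ν i *
      (√n * ((1 / n : ℝ) * ∑ k ∈ Finset.Ico 1 n, g i (k / n) - ∫ x in (0 : ℝ)..1, g i x)) =
      √n * ((1 / n : ℝ) * ∑ k ∈ Finset.Ico 1 n,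
        ∑ i ∈ Finset.Icc 1 q, g i (k / n) * φ (1 / n) ^ ν i -
        ∑ i ∈ Finset.Icc 1 q, (∫ x in (0 : ℝ)..1, g i x) * φ (1 / n) ^ ν i) := by
    rw [Finset.sum_comm, Finset.mul_sum, ← Finset.sum_sub_distrib, Finset.mul_sum]
    refine Finset.sum_congr rfl fun i _ => ?_
    rw [← Finset.sum_mul]
    ring
  rw [e1]
  simp_rw [Finset.sum_sub_distrib]
  ring

/-- The functions g_i are bounded and the powers of `φ` vanish, so in the limiting variance only `g
0` survives, although the other terms may matter for the mean at scale n^{-1/2}. -/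
lemma eventually_diag_close {q : ℕ} {g : ℕ → ℝ → ℝ} {ν : ℕ → ℝ} {φ : ℝ → ℝ} {a : ℕ → ℕ → ℝ}
    (hg : ∀ i ≤ q, ∃ K r : ℝ≥0, 1 / 2 < r ∧ HolderOnWith K r (g i) (Ioo 0 1))
    (hφ : ∀ i ∈ Finset.Icc 1 q, Tendsto (fun n : ℕ => φ (1 / n) ^ ν i) atTop (𝓝 0))
    (ha : ∀ ε > 0, ∀ᶠ n : ℕ in atTop, ∀ k ∈ Finset.Ico 1 n,
      |a n k - g 0 (k / n) - ∑ i ∈ Finset.Icc 1 q, g i (k / n) * φ (1 / n) ^ ν i| ≤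
        ε * √(1 / n)) {ε : ℝ} (hε : 0 < ε) :
    ∀ᶠ n : ℕ in atTop, ∀ k ∈ Finset.Ico 1 n, |a n k - g 0 (k / n)| ≤ ε := by
  have hM : ∀ i, ∃ M, i ≤ q → 0 ≤ M ∧ ∀ x ∈ Ioo (0 : ℝ) 1, |g i x| ≤ M := by
    intro i
    by_cases hi : i ≤ q
    · obtain ⟨K, r, -, hK⟩ := hg i hi
      obtain ⟨M, hM⟩ := exists_bound_of_holder hK
      exact ⟨M, fun _ => hM⟩
    · exact ⟨0, fun h => absurd h hi⟩
  choose M hM using hM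
  have h1 : Tendsto (fun n : ℕ => ∑ i ∈ Finset.Icc 1 q, M i * |φ (1 / n) ^ ν i|) atTop (𝓝 0) := by
    have := tendsto_finsetSum (Finset.Icc 1 q) fun i hi => ((hφ i hi).abs).const_mul (M i)
    simpa using this
  filter_upwards [ha _ (half_pos hε), h1.eventually (gt_mem_nhds (half_pos hε)),
    eventually_gt_atTop 0] with n h2 h3 h4 k hk
  have hn1 : (1 : ℝ) ≤ n := by exact_mod_cast h4
  have h5 : √(1 / n : ℝ) ≤ 1 :=
    Real.sqrt_le_one.2 (div_le_one_of_le₀ hn1 (by positivity))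
  have h6 : |∑ i ∈ Finset.Icc 1 q, g i (k / n) * φ (1 / n) ^ ν i| ≤
      ∑ i ∈ Finset.Icc 1 q, M i * |φ (1 / n) ^ ν i| := by
    refine (Finset.abs_sum_le_sum_abs _ _).trans (Finset.sum_le_sum fun i hi => ?_)
    rw [abs_mul]
    exact mul_le_mul_of_nonneg_right ((hM i (Finset.mem_Icc.1 hi).2).2 _
      (div_mem_Ioo (m := 0) (by simpa using hk))) (abs_nonneg _)
  have h7 := h2 k hk
  have h8 : ε / 2 * √(1 / n : ℝ) ≤ ε / 2 := mul_le_of_le_one_right (by positivity) h5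
  set s := ∑ i ∈ Finset.Icc 1 q, g i (k / n) * φ (1 / n) ^ ν i
  calc |a n k - g 0 (k / n)| = |(a n k - g 0 (k / n) - s) + s| := by ring_nf
    _ ≤ _ := abs_add_le _ _
    _ ≤ ε := by linarith

/-- The limits of the normalised squared covariances along the diagonals. -/
noncomputable def diagLimit (γ : ℝ) (g₀ gt : ℝ → ℝ) (C : ℝ → ℝ → ℝ) : ℕ → ℝ
  | 0 => ∫ x in (0 : ℝ)..1, g₀ x ^ 2
  | 1 => ∫ x in (0 : ℝ)..1, gt x ^ 2
  | l + 2 => rho γ (l + 2) ^ 2 * ∫ x in (0 : ℝ)..1, C x x ^ 2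

/-- Every nonzero lag occurs on two diagonals; isolating lag 1 from the series leaves the squared
norm of ρ_γ. -/
lemma sigmaSq_eq_diagLimit {γ : ℝ} (hγ : γ ∈ Ioo (0 : ℝ) 2) (g₀ gt : ℝ → ℝ) (C : ℝ → ℝ → ℝ) :
    sigmaSq γ g₀ gt C =
      2 * (diagLimit γ g₀ gt C 0 + 2 * ∑' l, diagLimit γ g₀ gt C (l + 1)) := by
  have hs : Summable fun l => diagLimit γ g₀ gt C (l + 1) :=
    (summable_nat_add_iff 1).1 ((summable_rho_sq hγ).mul_right _)
  rw [hs.tsum_eq_zero_add]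
  have : ∑' l, diagLimit γ g₀ gt C (l + 1 + 1) =
      rhoNormSq γ * ∫ x in (0 : ℝ)..1, C x x ^ 2 := by
    rw [rhoNormSq, ← tsum_mul_right]
    rfl
  rw [this]
  simp only [sigmaSq, diagLimit]
  ring

lemma abs_le_of_abs_sub_le {x y ε M : ℝ} (h : |x - y| ≤ ε) (hy : |y| ≤ M) : |x| ≤ M + ε := by
  calc |x| = |y + (x - y)| := by ring_nf
    _ ≤ |y| + |x - y| := abs_add_le _ _
    _ ≤ M + ε := add_le_add hy h

lemma abs_le_of_diagonal_bound {a : ℕ → ℕ → ℝ} {b : ℕ → ℝ} {n : ℕ}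
    (hsymm : ∀ j k, a j k = a k j)
    (hab : ∀ l, ∀ k ∈ Finset.Ico 1 (n - l), |a (k + l) k| ≤ b l) {j k : ℕ}
    (hj : j ∈ Finset.Ico 1 n) (hk : k ∈ Finset.Ico 1 n) : |a j k| ≤ b (j - k + (k - j)) := by
  rw [Finset.mem_Ico] at hj hk
  rcases le_total k j with h | h
  · have := hab (j - k) k (Finset.mem_Ico.2 (by omega))
    rwa [show k + (j - k) = j by omega, show j - k = j - k + (k - j) by omega] at this
  · have := hab (k - j) j (Finset.mem_Ico.2 (by omega))
    rw [hsymm]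
    rwa [show j + (k - j) = k by omega, show k - j = j - k + (k - j) by omega] at this

/-- The factor in front of V_n, times the normalisation of the covariances, is n^{-1/2} whatever γ
and L are. -/
lemma scale_identity {n : ℕ} (hn : 0 < n) (γ : ℝ) {y : ℝ} (hy : y ≠ 0) :
    √n * ((n : ℝ) ^ (1 - γ) / y) * ((1 / n : ℝ) ^ (2 - γ) * y) = √n * (1 / n) := by
  have hn' : (0 : ℝ) < n := by exact_mod_cast hn
  have : (n : ℝ) ^ (1 - γ) * (1 / n : ℝ) ^ (2 - γ) = 1 / n := by
    rw [one_div, Real.inv_rpow hn'.le, ← Real.rpow_neg hn'.le, ← Real.rpow_add hn',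
      ← Real.rpow_neg_one]
    congr 1; ring
  calc _ = √n * ((n : ℝ) ^ (1 - γ) * (1 / n : ℝ) ^ (2 - γ)) * (y / y) := by ring
    _ = _ := by rw [this, div_self hy, mul_one]

/-- Diagonal limits and domination for the normalised covariances of the increments. -/
lemma exists_diagonal_bound {γ : ℝ} (hγ : γ ∈ Ioo (0 : ℝ) 2) {L : ℝ → ℝ} {C R D : ℝ → ℝ → ℝ}
    (hD : HasMixedDeriv R D)
    (hR : ContinuousOn (fun p : ℝ × ℝ => R p.1 p.2) (Icc 0 1 ×ˢ Icc 0 1))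
    (hL : IsSlowlyVarying L) (hLbdd : ∀ δ : ℝ, 0 < δ → BddAbove (L '' Icc δ 1))
    (hC : ContinuousOn (fun p : ℝ × ℝ => C p.1 p.2) triangle)
    (hDC : ∀ s t : ℝ, 0 < t → t < s → s < 1 → (s - t) ^ (2 + γ) / L (s - t) * D s t = C s t)
    {g₀ gt : ℝ → ℝ} {M₀ M₁ : ℝ} (hg₀c : ContinuousOn g₀ (Ioo 0 1))
    (hg₀ : ∀ x ∈ Ioo (0 : ℝ) 1, |g₀ x| ≤ M₀) (hgtc : ContinuousOn gt (Ioo 0 1))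
    (hgt : ∀ x ∈ Ioo (0 : ℝ) 1, |gt x| ≤ M₁) {a : ℕ → ℕ → ℕ → ℝ}
    (ha : ∀ n j k, a n j k = normDelta γ L R (1 / n) (j / n) (k / n))
    (h0 : ∀ ε > 0, ∀ᶠ n : ℕ in atTop, ∀ k ∈ Finset.Ico 1 n, |a n k k - g₀ (k / n)| ≤ ε)
    (h1 : ∀ ε > 0, ∀ᶠ n : ℕ in atTop, ∀ k ∈ Finset.Ico 1 (n - 1), |a n (k + 1) k - gt (k / n)| ≤ ε) :
    (∃ b : ℕ → ℝ, Summable b ∧ (∀ l, 0 ≤ b l) ∧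
      ∀ᶠ n in atTop, ∀ l, ∀ k ∈ Finset.Ico 1 (n - l), |a n (k + l) k| ≤ b l) ∧
    ∀ l, Tendsto (fun n : ℕ => (1 / n : ℝ) * ∑ k ∈ Finset.Ico 1 (n - l), a n (k + l) k ^ 2)
      atTop (𝓝 (diagLimit γ g₀ gt C l)) := by
  constructor
  · obtain ⟨h₀, hh₀, -, b, hb, hb0, hrep⟩ := normDelta_eq_integral hD hR hγ hL hLbdd hC hDC
    have hM₀ : 0 ≤ M₀ := (abs_nonneg _).trans (hg₀ (1 / 2) ⟨by norm_num, by norm_num⟩)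
    have hM₁ : 0 ≤ M₁ := (abs_nonneg _).trans (hgt (1 / 2) ⟨by norm_num, by norm_num⟩)
    -- Lags 0 and 1 are dominated by the bounds of their limit functions plus 1, as the uniform
    -- error is eventually at most 1. From lag 2 on, the kernel estimate supplies the summable tail.
    refine ⟨fun l => match l with | 0 => M₀ + 1 | 1 => M₁ + 1 | l + 2 => b (l + 2), ?_, ?_, ?_⟩
    · rw [← summable_nat_add_iff 2]
      exact (summable_nat_add_iff 2).2 hb
    · intro l
      match l with
      | 0 => simp only; linarith
      | 1 => simp only; linarith
      | l + 2 => exact hb0 _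
    · filter_upwards [h0 1 one_pos, h1 1 one_pos,
        tendsto_one_div_nhdsGT.eventually (Ioc_mem_nhdsGT hh₀)] with n e0 e1 en l k hk
      match l with
      | 0 => exact abs_le_of_abs_sub_le (e0 k (by simpa using hk)) (hg₀ _ (div_mem_Ioo hk))
      | 1 => exact abs_le_of_abs_sub_le (e1 k hk) (hgt _ (div_mem_Ioo hk))
      | l + 2 =>
        rw [ha, natCast_add_div]
        have hgrid := grid_bounds hk
        exact (hrep _ en (l + 2) (by omega) _ hgrid.1 hgrid.2).2.2
  · intro l
    match l with
    | 0 =>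
      exact tendsto_riemann_sum_sq hg₀c hg₀ 0 (a := fun n k => a n (k + 0) k)
        fun ε hε => by simpa using h0 ε hε
    | 1 => exact tendsto_riemann_sum_sq hgtc hgt 1 h1
    | l + 2 =>
      obtain ⟨M, hM0, hM⟩ := exists_truncC_bound hC
      have hdiag : ∀ x ∈ Icc (0 : ℝ) 1, (x, x) ∈ triangle := fun x hx => ⟨hx.1, le_rfl, hx.2⟩
      have hCM : ∀ x ∈ Ioo (0 : ℝ) 1, |rho γ (l + 2) * C x x| ≤ |rho γ (l + 2)| * M := by
        intro x hx
        have := hM (x, x)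
        rw [truncC, indicator_of_mem (hdiag x (Ioo_subset_Icc_self hx))] at this
        rw [abs_mul]
        gcongr
      have hCc : ContinuousOn (fun x => rho γ (l + 2) * C x x) (Ioo 0 1) :=
        (hC.comp (f := fun x : ℝ => (x, x)) (by fun_prop)
          fun x hx => hdiag x (Ioo_subset_Icc_self hx)).const_mul _
      have := tendsto_riemann_sum_sq hCc hCM (l + 2) (a := fun n k => a n (k + (l + 2)) k) ?_
      · simp only [mul_pow, intervalIntegral.integral_const_mul] at this
        exact this
      · intro ε hε
        filter_upwards [tendsto_one_div_nhdsGT.eventually (normDelta_tendsto_uniformly hD hR hγ hL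
          hLbdd hC hDC (l := l + 2) (by omega) hε)] with n hn k hk
        rw [ha, natCast_add_div]
        have hgrid := grid_bounds hk
        exact hn _ hgrid.1 hgrid.2

end QuadVar

/-! ### The central limit theorem for the quadratic variation. -/

theorem theorem2
    {Ω : Type*} [MeasurableSpace Ω] (P : Measure Ω) [IsProbabilityMeasure P]
    (X : ℝ → Ω → ℝ)
    -- `X = {X_t ; t ∈ [0, 1]}` is a centered Gaussian process
    (hGauss : IsGaussianProcess (fun t : Icc (0 : ℝ) 1 => X t) P)
    (hCent : ∀ t ∈ Icc (0 : ℝ) 1, ∫ ω, X t ω ∂P = 0)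
    -- its covariance function
    (R : ℝ → ℝ → ℝ) (hR : R = QuadVar.covFun P X)
    (hRcont : ContinuousOn (fun p : ℝ × ℝ => R p.1 p.2) (Icc 0 1 ×ˢ Icc 0 1))
    -- the fourth-order mixed derivative and its behaviour at the diagonal
    (D : ℝ → ℝ → ℝ) (hD : QuadVar.HasMixedDeriv R D)
    (C : ℝ → ℝ → ℝ)
    (hC : ContinuousOn (fun p : ℝ × ℝ => C p.1 p.2) {p | 0 ≤ p.2 ∧ p.2 ≤ p.1 ∧ p.1 ≤ 1})
    (γ : ℝ) (hγ : γ ∈ Ioo (0 : ℝ) 2)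
    (L : ℝ → ℝ) (hL : QuadVar.IsSlowlyVarying L)
    (hLbdd : ∀ δ : ℝ, 0 < δ → BddAbove (L '' Icc δ 1))
    (hDC : ∀ s t : ℝ, 0 < t → t < s → s < 1 →
      (s - t) ^ (2 + γ) / L (s - t) * D s t = C s t)
    -- the expansion on the diagonal
    (q : ℕ) (g : ℕ → ℝ → ℝ) (ν : ℕ → ℝ) (φ : ℝ → ℝ)
    (hνpos : ∀ i, 1 ≤ i → i ≤ q → 0 < ν i)
    (hνmono : ∀ i j, 1 ≤ i → i < j → j ≤ q → ν i < ν j)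
    (hφpos : ∀ h ∈ Ioo (0 : ℝ) 1, 0 < φ h)
    (hgLip : ∀ i < q, ∃ K : ℝ≥0, LipschitzOnWith K (g i) (Ioo 0 1))
    (hgHol : ∃ α : ℝ≥0, 0 < α ∧ α ≤ 1 / 2 ∧ ∃ K : ℝ≥0, HolderOnWith K (1 / 2 + α) (g q) (Ioo 0 1))
    (hg0 : ∃ t ∈ Ioo (0 : ℝ) 1, g 0 t ≠ 0)
    (hφlim : q ≠ 0 → Tendsto φ (𝓝[>] 0) (𝓝 0))
    (hdiag : Tendsto
      (fun h : ℝ => QuadVar.supAbs (Icc h (1 - h)) (fun t =>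
          QuadVar.delta1 h (QuadVar.delta2 h R) t t / (h ^ (2 - γ) * L h)
            - g 0 t - ∑ i ∈ Finset.Icc 1 q, g i t * φ h ^ ν i)
        / ENNReal.ofReal (Real.sqrt h))
      (𝓝[>] 0) (𝓝 0))
    -- the first off-diagonal increments
    (gt : ℝ → ℝ) (hgtbdd : ∃ M : ℝ, ∀ t ∈ Ioo (0 : ℝ) 1, |gt t| ≤ M)
    (hoff : Tendsto
      (fun h : ℝ => QuadVar.supAbs (Icc h (1 - 2 * h)) (fun t =>
          QuadVar.delta1 h (QuadVar.delta2 h R) (t + h) t / (h ^ (2 - γ) * L h) - gt t))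
      (𝓝[>] 0) (𝓝 0)) :
    -- the limits are given by convergent integrals and a convergent series
    (∀ i ≤ q, IntervalIntegrable (g i) volume 0 1) ∧
    IntervalIntegrable (fun x => g 0 x ^ 2) volume 0 1 ∧
    IntervalIntegrable (fun x => gt x ^ 2) volume 0 1 ∧
    IntervalIntegrable (fun x => C x x ^ 2) volume 0 1 ∧
    Summable (fun l : ℕ => QuadVar.rho γ (l + 2) ^ 2) ∧
    -- convergence in law
    TendstoInDistribution
      (fun (n : ℕ) (ω : Ω) => Real.sqrt n *
        ((n : ℝ) ^ (1 - γ) / L (1 / n) * QuadVar.V X n ω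
          - (∫ x in (0 : ℝ)..1, g 0 x)
          - ∑ i ∈ Finset.Icc 1 q, (∫ x in (0 : ℝ)..1, g i x) * φ (1 / n) ^ ν i))
      atTop (id : ℝ → ℝ) (fun _ => P)
      (gaussianReal 0 (Real.toNNReal (QuadVar.sigmaSq γ (g 0) gt C))) := by
  have hg := QuadVar.holder_exponents hgLip hgHol
  have hgint : ∀ i ≤ q, ContinuousOn (g i) (Ioo 0 1) ∧
      ∃ M, ∀ x ∈ Ioo (0 : ℝ) 1, |g i x| ≤ M := by
    intro i hi
    obtain ⟨K, r, hr, hK⟩ := hg i hi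
    obtain ⟨M, -, hM⟩ := QuadVar.exists_bound_of_holder hK
    exact ⟨hK.continuousOn (lt_of_le_of_lt (by positivity) hr), M, hM⟩
  obtain ⟨hg₀c, M₀, hM₀⟩ := hgint 0 (Nat.zero_le q)
  obtain ⟨M₁, hM₁⟩ := hgtbdd
  have hgtc := QuadVar.continuousOn_of_tendsto_supAbs hRcont hoff
  have hsq : ∀ {f : ℝ → ℝ} {M : ℝ}, (∀ x ∈ Ioo (0 : ℝ) 1, |f x| ≤ M) →
      ∀ x ∈ Ioo (0 : ℝ) 1, |f x ^ 2| ≤ M ^ 2 := by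
    intro f M hf x hx
    rw [abs_pow]
    exact pow_le_pow_left₀ (abs_nonneg _) (hf x hx) 2
  refine ⟨fun i hi => ?_, QuadVar.intervalIntegrable_of_continuousOn_Ioo (hg₀c.pow 2) (hsq hM₀),
    QuadVar.intervalIntegrable_of_continuousOn_Ioo (hgtc.pow 2) (hsq hM₁), ?_,
    QuadVar.summable_rho_sq hγ, ?_⟩
  · obtain ⟨hc, M, hM⟩ := hgint i hi
    exact QuadVar.intervalIntegrable_of_continuousOn_Ioo hc hM
  · refine ContinuousOn.intervalIntegrable (ContinuousOn.pow ?_ 2)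
    rw [uIcc_of_le zero_le_one]
    exact hC.comp (f := fun x : ℝ => (x, x)) (by fun_prop) fun x hx => ⟨hx.1, le_rfl, hx.2⟩
  set a : ℕ → ℕ → ℕ → ℝ := fun n j k => QuadVar.normDelta γ L R (1 / n) (j / n) (k / n) with ha
  have hRsymm : ∀ s t, R s t = R t s := fun s t => by
    rw [hR]; exact covariance_comm _ _
  have hasymm : ∀ n j k, a n j k = a n k j := fun n j k => by
    simp only [ha, QuadVar.normDelta]
    rw [QuadVar.delta_symm hRsymm]
  have hφ : ∀ i ∈ Finset.Icc 1 q, Tendsto (fun n : ℕ => φ (1 / n) ^ ν i) atTop (𝓝 0) :=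
    fun i hi => QuadVar.tendsto_rpow_one_div hνpos hφlim hi
  have hdiag' : ∀ ε > 0, ∀ᶠ n : ℕ in atTop, ∀ k ∈ Finset.Ico 1 n,
      |a n k k - g 0 (k / n) - ∑ i ∈ Finset.Icc 1 q, g i (k / n) * φ (1 / n) ^ ν i| ≤
        ε * √(1 / n) := by
    intro ε hε
    filter_upwards [QuadVar.tendsto_one_div_nhdsGT.eventually
      (QuadVar.eventually_abs_le_of_tendsto_supAbs_div_sqrt hdiag hε)] with n hn k hk
    have hgrid := QuadVar.grid_bounds (l := 0) (n := n) (k := k) (by simpa using hk)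
    push_cast at hgrid
    exact hn _ ⟨hgrid.1, by linarith [hgrid.2]⟩
  have h0 : ∀ ε > 0, ∀ᶠ n : ℕ in atTop, ∀ k ∈ Finset.Ico 1 n, |a n k k - g 0 (k / n)| ≤ ε :=
    fun ε hε => QuadVar.eventually_diag_close hg hφ hdiag' hε
  have h1 : ∀ ε > 0, ∀ᶠ n : ℕ in atTop, ∀ k ∈ Finset.Ico 1 (n - 1),
      |a n (k + 1) k - gt (k / n)| ≤ ε := by
    intro ε hε
    filter_upwards [QuadVar.tendsto_one_div_nhdsGT.eventually
      (QuadVar.eventually_abs_le_of_tendsto_supAbs hoff hε)] with n hn k hk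
    have hgrid := QuadVar.grid_bounds hk
    push_cast at hgrid
    have := hn (k / n) ⟨hgrid.1, by linarith [hgrid.2]⟩
    simp only [ha, QuadVar.normDelta]
    rwa [QuadVar.natCast_add_div, Nat.cast_one, one_mul]
  obtain ⟨⟨b, hb, hb0, hab⟩, hT⟩ := QuadVar.exists_diagonal_bound hγ hD hRcont hL hLbdd hC hDC
    hg₀c hM₀ hgtc hM₁ (a := a) (fun n j k => rfl) h0 h1
  have hsum := QuadVar.tendsto_double_sum_of_diagonals hasymm hb hb0 hab hT
  have hbias := QuadVar.tendsto_bias (a := fun n k => a n k k) hg hφ hdiag'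
  have hLpos : ∀ n : ℕ, 0 < n → 0 < L (1 / n) := fun n hn => by
    have h2 : (1 : ℝ) ≤ n := by exact_mod_cast hn
    exact hL.pos _ ⟨by positivity, div_le_one_of_le₀ h2 (by positivity)⟩
  -- The scaled covariance matrix is n^{-1/2} times `a n`, so its squared entries carry the weight
  -- 1/n of a Riemann sum.
  have hcov : ∀ n : ℕ, 0 < n → ∀ i j : ↥(Finset.Ico 1 n),
      √n * ((n : ℝ) ^ (1 - γ) / L (1 / n)) * cov[QuadVar.incr X n i, QuadVar.incr X n j; P] =
        √n * (1 / n) * a n i j := by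
    intro n hn i j
    have hn' : (0 : ℝ) < n := by exact_mod_cast hn
    have hpos : 0 < (1 / n : ℝ) ^ (2 - γ) * L (1 / n) :=
      mul_pos (Real.rpow_pos_of_pos (by positivity) _) (hLpos n hn)
    rw [QuadVar.covariance_incr hGauss i.2 j.2, ← hR,
      ← QuadVar.scale_identity hn γ (hLpos n hn).ne', mul_assoc _ (_ * _) (a n i j)]
    congr 1
    simp only [ha, QuadVar.normDelta]
    rw [mul_div_cancel₀ _ hpos.ne']
  have hsqrt : ∀ n : ℕ, 0 < n → (√n * (1 / n : ℝ)) ^ 2 = 1 / n := fun n hn => by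
    have hn' : (0 : ℝ) < n := by exact_mod_cast hn
    rw [mul_pow, Real.sq_sqrt hn'.le]
    field_simp
  refine QuadVar.tendstoInDistribution_sum_sq (ι := fun n => ↥(Finset.Ico 1 n))
    (Z := fun n i => QuadVar.incr X n i) (c := fun n => √n * ((n : ℝ) ^ (1 - γ) / L (1 / n)))
    (fun n => QuadVar.hasGaussianLaw_incr hGauss n)
    (fun n i => QuadVar.integral_incr hGauss hCent i.2) hbias ?_ ?_ ?_ ?_
  · rw [QuadVar.sigmaSq_eq_diagLimit hγ]
    refine (hsum.const_mul 2).congr' ?_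
    filter_upwards [eventually_gt_atTop 0] with n hn
    have e : ∀ i j : ↥(Finset.Ico 1 n), (√n * ((n : ℝ) ^ (1 - γ) / L (1 / n))) ^ 2 *
        cov[QuadVar.incr X n i, QuadVar.incr X n j; P] ^ 2 = 1 / n * a n i j ^ 2 := by
      intro i j
      rw [← mul_pow, hcov n hn i j, mul_pow, hsqrt n hn]
    simp_rw [Finset.mul_sum, e, ← Finset.mul_sum]
    rw [← Finset.sum_coe_sort (Finset.Ico 1 n)]
    congr 2
    refine Finset.sum_congr rfl fun i _ => ?_
    rw [← Finset.sum_coe_sort (Finset.Ico 1 n)]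
  · intro δ hδ
    -- Row sums of `a n` are at most twice the sum of `b`, so scaled row sums are O(n^{-1/2}),
    -- uniformly over the rows.
    have hlim : Tendsto (fun n : ℕ => √n * (1 / n : ℝ) * (2 * ∑' l, b l)) atTop (𝓝 0) := by
      have h2 : Tendsto (fun n : ℕ => (√(n : ℝ))⁻¹) atTop (𝓝 0) :=
        tendsto_inv_atTop_zero.comp (Real.tendsto_sqrt_atTop.comp tendsto_natCast_atTop_atTop)
      have h3 := h2.mul_const (2 * ∑' l, b l)
      rw [zero_mul] at h3
      refine h3.congr fun n => ?_
      rw [mul_one_div, Real.sqrt_div_self', one_div]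
    filter_upwards [hlim.eventually (gt_mem_nhds hδ), hab, eventually_gt_atTop 0]
      with n hn hn2 hn3 i
    refine lt_of_le_of_lt ?_ hn
    have e : ∀ j : ↥(Finset.Ico 1 n), |√n * ((n : ℝ) ^ (1 - γ) / L (1 / n))| *
        |cov[QuadVar.incr X n i, QuadVar.incr X n j; P]| = √n * (1 / n) * |a n i j| := by
      intro j
      rw [← abs_mul, hcov n hn3 i j, abs_mul, abs_of_nonneg (by positivity)]
    rw [Finset.mul_sum]
    simp_rw [e]
    rw [← Finset.mul_sum]
    gcongr
    rw [Finset.sum_coe_sort (Finset.Ico 1 n) fun j => |a n i j|]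
    refine (Finset.sum_le_sum fun j hj => ?_).trans
      (QuadVar.sum_le_two_mul_tsum hb hb0 (Finset.Ico 1 n) i)
    exact QuadVar.abs_le_of_diagonal_bound (hasymm n) hn2 i.2 hj
  · intro n
    have hV : AEMeasurable (fun ω => QuadVar.V X n ω) P := by
      simp_rw [QuadVar.V_eq_sum_incr]
      exact Finset.aemeasurable_fun_sum _ fun i _ =>
        ((QuadVar.hasGaussianLaw_incr hGauss n).eval i).aemeasurable.pow_const 2
    exact (((hV.const_mul _).sub_const _).sub_const _).const_mul _
  -- The statistic is the centered sum of squares plus the deterministic bias, the scaled mean of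
  -- V_n being √n times the Riemann sum of the diagonal terms. This is claimed only for n > 0, where
  -- division by n is meaningful.
  · filter_upwards [eventually_gt_atTop 0] with n hn
    funext ω
    have e : √n * ((n : ℝ) ^ (1 - γ) / L (1 / n)) *
        ∑ i : ↥(Finset.Ico 1 n), cov[QuadVar.incr X n i, QuadVar.incr X n i; P] =
        √n * ((1 / n : ℝ) * ∑ k ∈ Finset.Ico 1 n, a n k k) := by
      rw [Finset.mul_sum]
      simp_rw [hcov n hn]
      rw [← Finset.mul_sum, Finset.sum_coe_sort (Finset.Ico 1 n) fun k => a n k k, mul_assoc]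
    rw [mul_sub _ _ (∑ i : ↥(Finset.Ico 1 n), cov[QuadVar.incr X n i, QuadVar.incr X n i; P]), e,
      ← QuadVar.V_eq_sum_incr]
    ring
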